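/- Let $\mathbf k$ be a field, $\lambda\in\mathbf k$ with $\lambda\neq 0$, let $\Omega=\{D,P\}$, and let $Z$ be a set with a well order $\leq_Z$. Let $\mathfrak S(Z)$ be the free $\Omega$-semigroup on $Z$ (its elements are the nonempty bracketed words in $Z$ with brackets $D(\cdot)=\lfloor\cdot\rfloor_D$ and $P(\cdot)=\lfloor\cdot\rfloor_P$), and $\mathbf k\mathfrak S(Z)$ the free nonunital $\Omega$-algebra on $Z$, the operators being extended linearly. Each $u\in\mathfrak S(Z)$ is uniquely a product $u_1\cdots u_b$ of letters $u_i\in Z\sqcup\lfloor\mathfrak S(Z)\rfloor_D\sqcup\lfloor\mathfrak S(Z)\rfloor_P$; $|u|=b$ is its breadth. *The order.* For $u\in\mathfrak S(Z)$ let $\deg_D(u)$, $\deg_P(u)$, $\deg_Z(u)$ be the numbers of occurrences of $\lfloor\ \rfloor_D$, of $\lfloor\ \rfloor_P$, and of elements of $Z$ in $u$. Let $\deg_{GD}(u)$ be the sum, over all right half brackets $\rfloor_D$ in $u$, of the number of occurrences of elements of $Z$ to the right of it, and $\deg_{GP}(u)$ the sum, over all brackets $\lfloor\ \rfloor_P$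 in $u$, of the number of occurrences of elements of $Z$ in $u$ outside of it. Let $\leq_{\mathrm{Dlex}}$ be the recursively defined linear order comparing words first by breadth and, for equal breadth, at the first letter where they differ, where letters are ordered by $z<\lfloor s\rfloor_D<\lfloor t\rfloor_P$ for all $z\in Z$, $s,t\in\mathfrak S(Z)$, by $\leq_Z$ on $Z$, and by $\lfloor s\rfloor_\omega<\lfloor t\rfloor_\omega\Leftrightarrow s<_{\mathrm{Dlex}}t$. Then $\leq_{\mathrm{PD}}$ compares words lexicographically by $\deg_D$, $\deg_P$, $\deg_Z$, $\deg_{GD}$, $\deg_{GP}$ and finally $\leq_{\mathrm{Dlex}}$. *$\Omega$-GS systems.* Let $\mathfrak S^\star(Z)$ be the set of words over $Z\cup\{\star\}$ in which $\star$ occurs exactly once; $q|_u$ denotes $q$ with $\star$ replaced by $u$, extended linearly in $u$. A monomial order on $\mathfrak S(Z)$ is a well order $\leq$ such that $u<v$ implies $q|_u<q|_v$ for all $q\in\mathfrak S^\star(Z)$. For a nonzero $f\in\mathbf k\mathfrak S(Z)$ let $\bar f$ be its largest monomial; $f$ is monic if $\bar f$ has coefficient $1$. For $G\subseteq\mathbf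 k\mathfrak S(Z)$ and $p\in\mathfrak S(Z)$, an element is trivial modulo $(G,p)$ if it is a finite sum $\sum_i c_i\,q_i|_{s_i}$ with $c_i\in\mathbf k$, $q_i\in\mathfrak S^\star(Z)$, $0\ne s_i\in G$ and $q_i|_{\bar s_i}<p$. The set $G$ is an $\Omega$-GS basis with respect to $\leq$ if for all $f,g$ obtained from nonzero elements of $G$ by dividing by the leading coefficient: every intersection composition $fu-vg$ (where $p=\bar f u=v\bar g$ with $u,v\in\mathfrak S(Z)$ and $\max\{|\bar f|,|\bar g|\}<|p|<|\bar f|+|\bar g|$) and every inclusion composition $f-q|_g$ (where $p=\bar f=q|_{\bar g}$ with $q\in\mathfrak S^\star(Z)$) is trivial modulo $(G,p)$. A set $\Phi$ of operated polynomial identities is $\Omega$-GS in $\mathbf k\mathfrak S(Z)$ with respect to $\leq$ if $\leq$ is a monomial order on $\mathfrak S(Z)$ and the set $S_\Phi(\mathfrak S(Z))$ of all $\phi(u_1,\dots,u_n)$ with $\phi\in\Phi$, $u_i\in\mathfrak S(Z)$, is an $\Omega$-GS basis with respect to $\leq$. **Theorem.** The set $\Phi_{\mathsf{DRB}}=\{\phi_1,\dots,\phi_5\}$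 consisting of - $\phi_1(x,y)=P(x)P(y)-P(xP(y))-P(P(x)y)-\lambda P(xy)$, - $\phi_2(x,y)=D(x)D(y)+\lambda^{-1}D(x)y+\lambda^{-1}xD(y)-\lambda^{-1}D(xy)$, - $\phi_3(x)=D(P(x))-x$, - $\phi_4(x,y)=P(x)D(y)-D(P(x)y)+xy+\lambda xD(y)$, - $\phi_5(x,y)=D(x)P(y)-D(xP(y))+xy+\lambda D(x)y$ is $\Omega$-GS in $\mathbf k\mathfrak S(Z)$ with respect to $\leq_{\mathrm{PD}}$. -/

import Mathlib

/-- The free `Ω`-semigroup `𝔖(Z)` on a set `Z`: nonempty bracketed words.  A word is a nonempty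
product of letters, a letter being either a variable `z ∈ Z` or a bracketed word `⌊w⌋_ω`; so each
word has exactly one of the forms `z`, `⌊w⌋_ω`, `z v`, `⌊w⌋_ω v` with `v`, `w` words. -/
inductive OpWord (Ω : Type*) (Z : Type*) where
  /-- the one-letter word `z` -/
  | var (z : Z) : OpWord Ω Z
  /-- the one-letter word `⌊w⌋_ω` -/
  | br (ω : Ω) (w : OpWord Ω Z) : OpWord Ω Z
  /-- the word `z v` -/
  | consVar (z : Z) (v : OpWord Ω Z) : OpWord Ω Z
  /-- the word `⌊w⌋_ω v` -/
  | consBr (ω : Ω) (w v : OpWord Ω Z) : OpWord Ω Z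

/-- The letters of bracketed words: the elements of `Z ⊔ ⌊𝔖(Z)⌋_Ω`. -/
inductive OpLetter (Ω : Type*) (Z : Type*) where
  | var (z : Z) : OpLetter Ω Z
  | br (ω : Ω) (w : OpWord Ω Z) : OpLetter Ω Z

namespace OpWord

/-- Concatenation of words. -/
def append {Ω Z : Type*} : OpWord Ω Z → OpWord Ω Z → OpWord Ω Z
  | var z, t => consVar z t
  | br ω w, t => consBr ω w t
  | consVar z v, t => consVar z (append v t)
  | consBr ω w v, t => consBr ω w (append v t)

instance {Ω Z : Type*} : Semigroup (OpWord Ω Z) where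
  mul := append
  mul_assoc a b c := by
    change append (append a b) c = append a (append b c)
    induction a <;> simp_all [append]

/-- The factorization of a word into letters. -/
def letters {Ω Z : Type*} : OpWord Ω Z → List (OpLetter Ω Z)
  | var z => [.var z]
  | br ω w => [.br ω w]
  | consVar z v => .var z :: letters v
  | consBr ω w v => .br ω w :: letters v

/-- The breadth `|u|`: the number of letters of `u`. -/
def breadth {Ω Z : Type*} (u : OpWord Ω Z) : ℕ := u.letters.length

/-- Simultaneous substitution of words for variables (the morphism of `Ω`-semigroups
`𝔖(Y) → 𝔖(Z)` that extends `σ`). -/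
def subst {Ω Y Z : Type*} (σ : Y → OpWord Ω Z) : OpWord Ω Y → OpWord Ω Z
  | var y => σ y
  | br ω w => br ω (subst σ w)
  | consVar y v => σ y * subst σ v
  | consBr ω w v => br ω (subst σ w) * subst σ v

/-- The sum of the weights `c z` over all occurrences of variables in a word. -/
def varWeight {Ω Z : Type*} (c : Z → ℕ) : OpWord Ω Z → ℕ
  | var z => c z
  | br _ w => varWeight c w
  | consVar z v => c z + varWeight c v
  | consBr _ w v => varWeight c w + varWeight c v

/-- `deg_Z`: the number of occurrences of elements of `Z`. -/
def degZ {Ω Z : Type*} (u : OpWord Ω Z) : ℕ := u.varWeight (fun _ => 1)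

/-- The number of occurrences of the bracket `⌊ ⌋_ω`. -/
def degOp {Ω Z : Type*} [DecidableEq Ω] (ω : Ω) : OpWord Ω Z → ℕ
  | var _ => 0
  | br ω' w => (if ω' = ω then 1 else 0) + degOp ω w
  | consVar _ v => degOp ω v
  | consBr ω' w v => (if ω' = ω then 1 else 0) + degOp ω w + degOp ω v

end OpWord

/-! ### Words with a hole -/

/-- `q ∈ 𝔖^⋆(Z)`: a word over `Z ∪ {⋆}` (`⋆` is `none`) in which `⋆` occurs exactly once. -/
def OpWord.IsStarWord {Ω Z : Type*} (q : OpWord Ω (Option Z)) : Prop :=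
  q.varWeight (fun o => o.elim 1 (fun _ => 0)) = 1

/-- `q|_u`: the symbol `⋆` in `q` is replaced by `u`. -/
def OpWord.plug {Ω Z : Type*} (q : OpWord Ω (Option Z)) (u : OpWord Ω Z) : OpWord Ω Z :=
  q.subst (fun o => o.elim u .var)

/-- `q|_s = ∑ cᵢ q|_{uᵢ}` for `s = ∑ cᵢ uᵢ` in the semigroup algebra `𝐤𝔖(Z)`. -/
noncomputable def OpWord.plugLin {k Ω Z : Type*} [Field k] (q : OpWord Ω (Option Z))
    (s : MonoidAlgebra k (OpWord Ω Z)) : MonoidAlgebra k (OpWord Ω Z) :=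
  MonoidAlgebra.mapDomain q.plug s

/-- A monomial order on `𝔖(Z)`: a well order such that `u < v` implies `q|_u < q|_v` for all
`q ∈ 𝔖^⋆(Z)`.  Here and below, `u < v` stands for `le u v ∧ u ≠ v`. -/
structure IsMonomialOrder {Ω Z : Type*} (le : OpWord Ω Z → OpWord Ω Z → Prop) : Prop where
  linear : IsLinearOrder (OpWord Ω Z) le
  wf : WellFounded (fun u v => le u v ∧ u ≠ v)
  compat : ∀ (q : OpWord Ω (Option Z)) (u v : OpWord Ω Z), q.IsStarWord →
    le u v → u ≠ v → le (q.plug u) (q.plug v) ∧ q.plug u ≠ q.plug v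

/-! ### Gröbner–Shirshov bases -/

section GS

variable {k Ω Z : Type*} [Field k]

/-- `m` is the leading monomial of `f`, i.e. the largest monomial occurring in `f`.
(No `m` is leading for `f = 0`.) -/
def IsLeadingMonomial (le : OpWord Ω Z → OpWord Ω Z → Prop)
    (f : MonoidAlgebra k (OpWord Ω Z)) (m : OpWord Ω Z) : Prop :=
  m ∈ f.coeff.support ∧ ∀ w ∈ f.coeff.support, le w m

/-- The nonzero elements of `G`, each divided by its leading coefficient. -/
def monicization (le : OpWord Ω Z → OpWord Ω Z → Prop)
    (G : Set (MonoidAlgebra k (OpWord Ω Z))) : Set (MonoidAlgebra k (OpWord Ω Z)) :=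
  {h | ∃ f ∈ G, ∃ m, IsLeadingMonomial le f m ∧ h = (f.coeff m)⁻¹ • f}

/-- `f` is trivial modulo `(G, p)`: `f = ∑ cᵢ qᵢ|_{sᵢ}` (a finite sum) with `cᵢ ∈ 𝐤`,
`qᵢ ∈ 𝔖^⋆(Z)`, `sᵢ ∈ G` and `qᵢ|_{s̄ᵢ} < p`. -/
def TrivialMod (le : OpWord Ω Z → OpWord Ω Z → Prop)
    (G : Set (MonoidAlgebra k (OpWord Ω Z))) (p : OpWord Ω Z)
    (f : MonoidAlgebra k (OpWord Ω Z)) : Prop :=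
  f ∈ Submodule.span k {h | ∃ (q : OpWord Ω (Option Z)) (s : MonoidAlgebra k (OpWord Ω Z))
    (m : OpWord Ω Z), q.IsStarWord ∧ s ∈ G ∧ IsLeadingMonomial le s m ∧
      (le (q.plug m) p ∧ q.plug m ≠ p) ∧ h = q.plugLin s}

/-- `G` is an `Ω`-GS basis in `𝐤𝔖(Z)` with respect to `le`: for all monicized `f`, `g` in `G`, with
leading monomials `f̄`, `ḡ`, all intersection compositions `f u - v g`
(for `p = f̄ u = v ḡ` with `max |f̄| |ḡ| < |p| < |f̄| + |ḡ|`) and all inclusion compositions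
`f - q|_g` (for `p = f̄ = q|_ḡ`, `q ∈ 𝔖^⋆(Z)`) are trivial modulo `(G, p)`. -/
structure IsGSBasis (le : OpWord Ω Z → OpWord Ω Z → Prop)
    (G : Set (MonoidAlgebra k (OpWord Ω Z))) : Prop where
  intersection : ∀ f ∈ monicization le G, ∀ g ∈ monicization le G, ∀ f' g' p u v : OpWord Ω Z,
    IsLeadingMonomial le f f' → IsLeadingMonomial le g g' →
    p = f' * u → p = v * g' →
    max f'.breadth g'.breadth < p.breadth → p.breadth < f'.breadth + g'.breadth →
    TrivialMod le G p (f * MonoidAlgebra.single u 1 - MonoidAlgebra.single v 1 * g)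
  inclusion : ∀ f ∈ monicization le G, ∀ g ∈ monicization le G, ∀ (f' g' p : OpWord Ω Z)
    (q : OpWord Ω (Option Z)), q.IsStarWord →
    IsLeadingMonomial le f f' → IsLeadingMonomial le g g' →
    p = f' → p = q.plug g' →
    TrivialMod le G p (f - q.plugLin g)

/-- `S_Φ(Y)`: all `φ(u_1, …, u_n)` with `φ ∈ Φ ⊆ 𝐤𝔖(X)` and words `u_i ∈ Y` substituted for the
variables. -/
def opiInstances {X : Type*} (Φ : Set (MonoidAlgebra k (OpWord Ω X))) (Y : Set (OpWord Ω Z)) :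
    Set (MonoidAlgebra k (OpWord Ω Z)) :=
  {f | ∃ φ ∈ Φ, ∃ σ : X → OpWord Ω Z, (∀ x, σ x ∈ Y) ∧
    f = MonoidAlgebra.mapDomain (OpWord.subst σ) φ}

/-- A family `Φ` of operated polynomial identities is `Ω`-GS in `𝐤𝔖(Z)` with respect to `le`:
`le` is a monomial order on `𝔖(Z)` and `S_Φ(𝔖(Z))` is an `Ω`-GS basis in `𝐤𝔖(Z)`. -/
def IsOmegaGS {X : Type*} (Φ : Set (MonoidAlgebra k (OpWord Ω X)))
    (le : OpWord Ω Z → OpWord Ω Z → Prop) : Prop :=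
  IsMonomialOrder le ∧ IsGSBasis le (opiInstances Φ (Set.univ : Set (OpWord Ω Z)))

end GS

/-! ### The monomial order `≤_PD` -/

/-- The index set `Ω = {D, P}` of the two operators. -/
inductive DPOp where
  | D : DPOp
  | P : DPOp
  deriving DecidableEq

namespace OpWord

/-- The sum of the GD-degrees of the half brackets `⌋_D` in a word that is followed by `r` further
elements of `Z`: a half bracket `⌋_D` has as degree the number of elements of `Z` to its right. -/
def degGDAux {Z : Type*} : ℕ → OpWord DPOp Z → ℕ
  | _, var _ => 0
  | r, br ω w => (if ω = .D then r else 0) + degGDAux r w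
  | r, consVar _ v => degGDAux r v
  | r, consBr ω w v =>
      (if ω = .D then v.degZ + r else 0) + degGDAux (v.degZ + r) w + degGDAux r v

/-- The GD-degree. -/
def degGD {Z : Type*} (u : OpWord DPOp Z) : ℕ := degGDAux 0 u

/-- The sum, over the brackets `⌊w⌋_P` in a word, of `n - deg_Z w`. -/
def degGPAux {Z : Type*} (n : ℕ) : OpWord DPOp Z → ℕ
  | var _ => 0
  | br ω w => (if ω = .P then n - w.degZ else 0) + degGPAux n w
  | consVar _ v => degGPAux n v
  | consBr ω w v => (if ω = .P then n - w.degZ else 0) + degGPAux n w + degGPAux n v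

/-- The GP-degree: a bracket `⌊w⌋_P` in `u` has as degree the number of elements of `Z` occurring
in `u` outside of it. -/
def degGP {Z : Type*} (u : OpWord DPOp Z) : ℕ := degGPAux u.degZ u

/-- The strict order `<_Dlex` on `𝔖(Z)`: the recursively defined degree-lexicographic order.
Words are compared by their breadth first; words of equal breadth are compared at the first
letter at which they differ, where letters are ordered by `z < ⌊s⌋_D < ⌊t⌋_P` for all `z`, `s`,
`t`, with `Z` carrying its own order and `⌊s⌋_ω < ⌊t⌋_ω` if and only if `s <_Dlex t`. -/
inductive DlexLT {Z : Type*} [LT Z] : OpWord DPOp Z → OpWord DPOp Z → Prop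
  | breadth {u v : OpWord DPOp Z} (h : u.breadth < v.breadth) : DlexLT u v
  | var_var {u v : OpWord DPOp Z} (h : u.breadth = v.breadth) {m n n' : List (OpLetter DPOp Z)}
      {z z' : Z} (hu : u.letters = m ++ .var z :: n) (hv : v.letters = m ++ .var z' :: n')
      (hz : z < z') : DlexLT u v
  | var_br {u v : OpWord DPOp Z} (h : u.breadth = v.breadth) {m n n' : List (OpLetter DPOp Z)}
      {z : Z} {ω : DPOp} {t : OpWord DPOp Z}
      (hu : u.letters = m ++ .var z :: n) (hv : v.letters = m ++ .br ω t :: n') : DlexLT u v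
  | D_P {u v : OpWord DPOp Z} (h : u.breadth = v.breadth) {m n n' : List (OpLetter DPOp Z)}
      {s t : OpWord DPOp Z}
      (hu : u.letters = m ++ .br .D s :: n) (hv : v.letters = m ++ .br .P t :: n') : DlexLT u v
  | br_br {u v : OpWord DPOp Z} (h : u.breadth = v.breadth) {m n n' : List (OpLetter DPOp Z)}
      {ω : DPOp} {s t : OpWord DPOp Z}
      (hu : u.letters = m ++ .br ω s :: n) (hv : v.letters = m ++ .br ω t :: n')
      (hst : DlexLT s t) : DlexLT u v

/-- The order `≤_PD`: compare `deg_D`, then `deg_P`, then `deg_Z`, then `deg_GD`, then `deg_GP`,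
then use `≤_Dlex`. -/
def PDle {Z : Type*} [LT Z] (u v : OpWord DPOp Z) : Prop :=
  u.degOp .D < v.degOp .D ∨ u.degOp .D = v.degOp .D ∧
  (u.degOp .P < v.degOp .P ∨ u.degOp .P = v.degOp .P ∧
  (u.degZ < v.degZ ∨ u.degZ = v.degZ ∧
  (u.degGD < v.degGD ∨ u.degGD = v.degGD ∧
  (u.degGP < v.degGP ∨ u.degGP = v.degGP ∧
  (u = v ∨ DlexLT u v)))))

end OpWord

/-! ### The differential Rota–Baxter identities -/

/-- The two variables `x`, `y` of the identities. -/
inductive OPIVar where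
  | x : OPIVar
  | y : OPIVar

namespace DRB

variable {k : Type*} [Field k]

/-- The linear operator `⌊ ⌋_D` on the free nonunital `Ω`-algebra `𝐤𝔖(X)`. -/
noncomputable def D {X : Type*} (f : MonoidAlgebra k (OpWord DPOp X)) :
    MonoidAlgebra k (OpWord DPOp X) :=
  MonoidAlgebra.mapDomain (OpWord.br .D) f

/-- The linear operator `⌊ ⌋_P` on the free nonunital `Ω`-algebra `𝐤𝔖(X)`. -/
noncomputable def P {X : Type*} (f : MonoidAlgebra k (OpWord DPOp X)) :
    MonoidAlgebra k (OpWord DPOp X) :=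
  MonoidAlgebra.mapDomain (OpWord.br .P) f

/-- The variable `x` in `𝐤𝔖({x, y})`. -/
noncomputable def x : MonoidAlgebra k (OpWord DPOp OPIVar) :=
  MonoidAlgebra.single (OpWord.var OPIVar.x) 1

/-- The variable `y` in `𝐤𝔖({x, y})`. -/
noncomputable def y : MonoidAlgebra k (OpWord DPOp OPIVar) :=
  MonoidAlgebra.single (OpWord.var OPIVar.y) 1

/-- The Rota–Baxter identity of weight `lam`. -/
noncomputable def φ₁ (lam : k) : MonoidAlgebra k (OpWord DPOp OPIVar) :=
  P x * P y - P (x * P y) - P (P x * y) - lam • P (x * y)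

/-- The Leibniz rule of weight `lam`, divided by `lam`. -/
noncomputable def φ₂ (lam : k) : MonoidAlgebra k (OpWord DPOp OPIVar) :=
  D x * D y + lam⁻¹ • (D x * y) + lam⁻¹ • (x * D y) - lam⁻¹ • D (x * y)

/-- The identity `D ∘ P = id`. -/
noncomputable def φ₃ : MonoidAlgebra k (OpWord DPOp OPIVar) :=
  D (P x) - x

/-- The identity `P(x)D(y) = D(P(x)y) - xy - lam xD(y)`. -/
noncomputable def φ₄ (lam : k) : MonoidAlgebra k (OpWord DPOp OPIVar) :=
  P x * D y - D (P x * y) + x * y + lam • (x * D y)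

/-- The identity `D(x)P(y) = D(xP(y)) - xy - lam D(x)y`. -/
noncomputable def φ₅ (lam : k) : MonoidAlgebra k (OpWord DPOp OPIVar) :=
  D x * P y - D (x * P y) + x * y + lam • (D x * y)

/-- The system of identities of differential Rota–Baxter algebras of nonzero weight `lam`. -/
noncomputable def dRB (lam : k) : Set (MonoidAlgebra k (OpWord DPOp OPIVar)) :=
  {φ₁ lam, φ₂ lam, φ₃, φ₄ lam, φ₅ lam}

end DRB

/-! The order is monomial for two reasons. The counts of `D`, `P` and variables are additive, and
the cross terms in the GD- and GP-degree of a product depend on a factor only through counts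
compared earlier, so comparisons survive products and brackets. And although `DlexLT` alone is not
well founded (`zz > D(zz) > D(D(zz)) > ⋯`), it is consulted only between words of equal size, where
it is a shortlex order over letters that contain smaller words (`wellFounded_boundedDlexLT`).

Each instance of an identity is then `m - r`, where `m` is `⌊u⌋_A ⌊v⌋_B` or `D(P(u))` and all
monomials of `r` lie below `m` (`IsRule.mem_below`). Only three kinds of overlap are not vacuous.
Two products overlap in a word `⌊u⌋_A ⌊v⌋_B ⌊w⌋_C`; eight explicit identities `composition_*` write
these compositions through smaller instances (`intersection_mem_below`). A factor of a product is
`D(P(a))`; four more identities settle this (`cancel_left_mem_below`, `cancel_right_mem_below`). Or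
the inner leading word sits inside an argument; then linearity of the outer identity in that
argument suffices, with no computation (`inclusion_left_mem_below` and its two companions).

Triviality modulo `p` is phrased as membership in a span `below (IsContext lam) p` of instances in
contexts, each attached to its leading word. The same formalism applied to plain words (`IsWord`)
yields the leading monomials. -/

namespace OpWord

/-! ### Products of words, letters, and additivity of the counts. -/

section Words

variable {Ω Z : Type*}

theorem br_mul (ω : Ω) (w v : OpWord Ω Z) : br ω w * v = consBr ω w v := rfl

theorem var_mul (z : Z) (v : OpWord Ω Z) : var z * v = consVar z v := rfl

theorem consBr_mul (ω : Ω) (w u v : OpWord Ω Z) : consBr ω w u * v = consBr ω w (u * v) := rfl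

theorem consVar_mul (z : Z) (u v : OpWord Ω Z) : consVar z u * v = consVar z (u * v) := rfl

theorem letters_mul (u v : OpWord Ω Z) : (u * v).letters = u.letters ++ v.letters := by
  induction u <;> simp_all [br_mul, var_mul, consBr_mul, consVar_mul, letters]

theorem letters_injective : Function.Injective (letters : OpWord Ω Z → _) := by
  have hne (u : OpWord Ω Z) : u.letters ≠ [] := by cases u <;> simp [letters]
  intro u
  induction u with
  | var z =>
    intro v h
    cases v <;> simp only [letters, List.cons.injEq, reduceCtorEq, false_and, and_true,
      OpLetter.var.injEq] at h
    · rw [h]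
    · exact absurd h.2.symm (hne _)
  | br ω w =>
    intro v h
    cases v <;> simp only [letters, List.cons.injEq, reduceCtorEq, false_and, and_true,
      OpLetter.br.injEq] at h
    · rw [h.1, h.2]
    · exact absurd h.2.symm (hne _)
  | consVar z v ih =>
    intro v' h
    cases v' <;> simp only [letters, List.cons.injEq, reduceCtorEq, false_and,
      OpLetter.var.injEq] at h
    · exact absurd h.2 (hne _)
    · rw [h.1, ih h.2]
  | consBr ω w v _ ih =>
    intro v' h
    cases v' <;> simp only [letters, List.cons.injEq, reduceCtorEq, false_and,
      OpLetter.br.injEq] at h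
    · exact absurd h.2 (hne _)
    · rw [h.1.1, h.1.2, ih h.2]

@[simp] theorem breadth_mul (u v : OpWord Ω Z) : (u * v).breadth = u.breadth + v.breadth := by
  simp [breadth, letters_mul]

@[simp] theorem breadth_br (ω : Ω) (w : OpWord Ω Z) : (br ω w).breadth = 1 := rfl

theorem breadth_pos (u : OpWord Ω Z) : 0 < u.breadth := by
  cases u <;> simp [breadth, letters]

theorem varWeight_mul (c : Z → ℕ) (u v : OpWord Ω Z) :
    (u * v).varWeight c = u.varWeight c + v.varWeight c := by
  induction u <;> simp_all [br_mul, var_mul, consBr_mul, consVar_mul, varWeight, add_assoc]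

@[simp] theorem degZ_var (z : Z) : (var z : OpWord Ω Z).degZ = 1 := rfl

@[simp] theorem degZ_br (ω : Ω) (w : OpWord Ω Z) : (br ω w).degZ = w.degZ := rfl

@[simp] theorem degZ_mul (u v : OpWord Ω Z) : (u * v).degZ = u.degZ + v.degZ :=
  varWeight_mul _ u v

theorem degZ_pos (u : OpWord Ω Z) : 0 < u.degZ := by
  unfold degZ
  induction u <;> simp_all [varWeight]

variable [DecidableEq Ω]

@[simp] theorem degOp_var (ω : Ω) (z : Z) : degOp ω (var z) = 0 := rfl

@[simp] theorem degOp_br (ω ω' : Ω) (w : OpWord Ω Z) :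
    degOp ω (br ω' w) = (if ω' = ω then 1 else 0) + degOp ω w := rfl

@[simp] theorem degOp_mul (ω : Ω) (u v : OpWord Ω Z) :
    degOp ω (u * v) = degOp ω u + degOp ω v := by
  induction u <;> simp_all [br_mul, var_mul, consBr_mul, consVar_mul, degOp, add_assoc]

end Words

/-! ### The GD- and GP-degree of a product. -/

section Degrees

variable {Z : Type*}

/-- Each half bracket `⌋_D` sees all `r` further variables, so the dependence on `r` is affine with
slope `degOp .D u`. -/
theorem degGDAux_eq (r : ℕ) (u : OpWord DPOp Z) :
    degGDAux r u = degGD u + r * degOp .D u := by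
  unfold degGD
  induction u generalizing r with
  | var z => simp [degGDAux, degOp]
  | br ω w ih =>
    simp only [degGDAux, degOp]
    rw [ih r]
    split_ifs <;> ring
  | consVar z v ih => simpa [degGDAux, degOp] using ih r
  | consBr ω w v ihw ihv =>
    simp only [degGDAux, degOp]
    rw [ihw (v.degZ + r), ihw (v.degZ + 0), ihv r]
    split_ifs <;> ring

@[simp] theorem degGD_br (ω : DPOp) (w : OpWord DPOp Z) : (br ω w).degGD = w.degGD := by
  simp [degGD, degGDAux]

@[simp] theorem degGD_mul (u v : OpWord DPOp Z) :
    (u * v).degGD = u.degGD + v.degZ * u.degOp .D + v.degGD := by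
  rw [← degGDAux_eq]
  unfold degGD
  induction u with
  | var z => simp [var_mul, degGDAux]
  | br ω w => simp [br_mul, degGDAux]
  | consVar z u ih => simpa [consVar_mul, degGDAux] using ih
  | consBr ω w u _ ih =>
    simp only [consBr_mul, degGDAux, degZ_mul, ih, add_zero]
    ring

/-- The bound on `u.degZ` ensures that no subtraction in `degGPAux` is truncated; each `P`-bracket
then gains exactly `n`. -/
theorem degGPAux_add (n m : ℕ) (u : OpWord DPOp Z) (h : u.degZ ≤ m) :
    degGPAux (m + n) u = degGPAux m u + n * degOp .P u := by
  induction u with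
  | var z => simp [degGPAux, degOp]
  | br ω w ih =>
    have h1 : w.degZ ≤ m := h
    have h2 : m + n - w.degZ = (m - w.degZ) + n := by omega
    simp only [degGPAux, degOp, ih h1, h2]
    split_ifs <;> ring
  | consVar z v ih =>
    rw [← var_mul, degZ_mul] at h
    simpa [degGPAux, degOp] using ih (by omega)
  | consBr ω w v ihw ihv =>
    rw [← br_mul, degZ_mul, degZ_br] at h
    have h2 : m + n - w.degZ = (m - w.degZ) + n := by omega
    simp only [degGPAux, degOp, ihw (by omega), ihv (by omega), h2]
    split_ifs <;> ring

theorem degGPAux_mul (n : ℕ) (u v : OpWord DPOp Z) :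
    degGPAux n (u * v) = degGPAux n u + degGPAux n v := by
  induction u <;>
    simp_all [br_mul, var_mul, consBr_mul, consVar_mul, degGPAux, add_assoc]

@[simp] theorem degGP_br (ω : DPOp) (w : OpWord DPOp Z) : (br ω w).degGP = w.degGP := by
  simp [degGP, degGPAux]

@[simp] theorem degGP_mul (u v : OpWord DPOp Z) :
    (u * v).degGP = u.degGP + v.degZ * u.degOp .P + (v.degGP + u.degZ * v.degOp .P) := by
  unfold degGP
  rw [degZ_mul, degGPAux_mul, degGPAux_add _ _ u le_rfl, add_comm u.degZ,
    degGPAux_add _ _ v le_rfl]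

end Degrees

/-- The number of letters in a word at all depths. -/
def size {Ω Z : Type*} : OpWord Ω Z → ℕ
  | var _ => 1
  | br _ w => size w + 1
  | consVar _ v => size v + 1
  | consBr _ w v => size w + size v + 1

theorem size_lt_of_mem_letters {Ω Z : Type*} {u w : OpWord Ω Z} {ω : Ω}
    (h : OpLetter.br ω w ∈ u.letters) : w.size < u.size := by
  induction u with
  | var z => simp [letters] at h
  | br ω' w' => simp [letters] at h; simp [h, size]
  | consVar z v ih => simp [letters] at h; have := ih h; simp only [size]; omega
  | consBr ω' w' v _ ih =>
    simp only [letters, List.mem_cons] at h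
    rcases h with h | h
    · cases h; simp only [size]; omega
    · have := ih h; simp only [size]; omega

theorem size_mul {Ω Z : Type*} (u v : OpWord Ω Z) : (u * v).size = u.size + v.size := by
  induction u <;> simp_all [br_mul, var_mul, consBr_mul, consVar_mul, size] <;> omega

/-- Consequently words that tie in the first three degrees have the same size, which is what makes
the final `DlexLT` comparison terminate. -/
theorem size_eq {Z : Type*} (u : OpWord DPOp Z) : u.size = u.degOp .D + u.degOp .P + u.degZ := by
  induction u with
  | var z => rfl
  | br ω w ih => cases ω <;> simp [size, ih] <;> ring
  | consVar z v ih => rw [← var_mul, size_mul, ih]; simp [size]; ring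
  | consBr ω w v ihw ihv =>
    rw [← br_mul, size_mul, ihv]; cases ω <;> simp [size, ihw] <;> ring

theorem size_pos {Ω Z : Type*} (u : OpWord Ω Z) : 0 < u.size := by cases u <;> simp [size]

/-! ### The order `DlexLT`: compatibility, well-foundedness at bounded size, trichotomy. -/

section Dlex

variable {Z : Type*} [LT Z]

theorem DlexLT.br {u v : OpWord DPOp Z} (h : DlexLT u v) (ω : DPOp) :
    DlexLT (br ω u) (br ω v) :=
  .br_br (m := []) (n := []) (n' := []) rfl rfl rfl h

theorem DlexLT.mul_right {u v : OpWord DPOp Z} (h : DlexLT u v) (w : OpWord DPOp Z) :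
    DlexLT (u * w) (v * w) := by
  cases h with
  | breadth h => exact .breadth (by simpa using h)
  | var_var h hu hv hz =>
    exact .var_var (by simp [h]) (by rw [letters_mul, hu]; simp; rfl)
      (by rw [letters_mul, hv]; simp; rfl) hz
  | var_br h hu hv =>
    exact .var_br (by simp [h]) (by rw [letters_mul, hu]; rw [List.append_assoc, List.cons_append])
      (by rw [letters_mul, hv]; rw [List.append_assoc, List.cons_append])
  | D_P h hu hv =>
    exact .D_P (by simp [h]) (by rw [letters_mul, hu]; rw [List.append_assoc, List.cons_append])
      (by rw [letters_mul, hv]; rw [List.append_assoc, List.cons_append])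
  | br_br h hu hv hst =>
    exact .br_br (by simp [h]) (by rw [letters_mul, hu]; rw [List.append_assoc, List.cons_append])
      (by rw [letters_mul, hv]; rw [List.append_assoc, List.cons_append]) hst

theorem DlexLT.mul_left {u v : OpWord DPOp Z} (h : DlexLT u v) (w : OpWord DPOp Z) :
    DlexLT (w * u) (w * v) := by
  cases h with
  | breadth h => exact .breadth (by simpa using h)
  | var_var h hu hv hz =>
    exact .var_var (by simp [h]) (by rw [letters_mul, hu, ← List.append_assoc])
      (by rw [letters_mul, hv, ← List.append_assoc]) hz
  | var_br h hu hv =>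
    exact .var_br (by simp [h]) (by rw [letters_mul, hu, ← List.append_assoc])
      (by rw [letters_mul, hv, ← List.append_assoc])
  | D_P h hu hv =>
    exact .D_P (by simp [h]) (by rw [letters_mul, hu, ← List.append_assoc])
      (by rw [letters_mul, hv, ← List.append_assoc])
  | br_br h hu hv hst =>
    exact .br_br (by simp [h]) (by rw [letters_mul, hu, ← List.append_assoc])
      (by rw [letters_mul, hv, ← List.append_assoc]) hst

/-- The order on letters that underlies `DlexLT`, restricted on bracketed letters to words of size
less than `n`. -/
inductive LetterLT (n : ℕ) : OpLetter DPOp Z → OpLetter DPOp Z → Prop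
  | var_var {z z' : Z} (h : z < z') : LetterLT n (.var z) (.var z')
  | var_br (z : Z) (ω : DPOp) (t : OpWord DPOp Z) : LetterLT n (.var z) (.br ω t)
  | D_P (s t : OpWord DPOp Z) : LetterLT n (.br .D s) (.br .P t)
  | br_br (ω : DPOp) {s t : OpWord DPOp Z} (hs : s.size < n) (ht : t.size < n) (h : DlexLT s t) :
      LetterLT n (.br ω s) (.br ω t)

theorem shortlex_letters {n : ℕ} {u v : OpWord DPOp Z} (hu : u.size ≤ n) (hv : v.size ≤ n)
    (h : DlexLT u v) : List.Shortlex (LetterLT n) u.letters v.letters := by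
  have key : ∀ {m l l' : List (OpLetter DPOp Z)} {a b : OpLetter DPOp Z},
      u.breadth = v.breadth → u.letters = m ++ a :: l → v.letters = m ++ b :: l' →
      LetterLT n a b → List.Shortlex (LetterLT n) u.letters v.letters := by
    intro m l l' a b h h1 h2 hab
    refine .of_lex h ?_
    rw [h1, h2]
    exact List.Lex.append_left _ (.rel hab) _
  cases h with
  | breadth h => exact .of_length_lt h
  | var_var h h1 h2 hz => exact key h h1 h2 (.var_var hz)
  | var_br h h1 h2 => exact key h h1 h2 (.var_br _ _ _)
  | D_P h h1 h2 => exact key h h1 h2 (.D_P _ _)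
  | br_br h h1 h2 hst =>
    refine key h h1 h2 (.br_br _ ?_ ?_ hst)
    · exact (size_lt_of_mem_letters (ω := _) (by rw [h1]; simp; exact .inr (.inl rfl))).trans_le hu
    · exact (size_lt_of_mem_letters (ω := _) (by rw [h2]; simp; exact .inr (.inl rfl))).trans_le hv

/-- The order `DlexLT` on words of size at most `n`. -/
def BoundedDlexLT (n : ℕ) (u v : OpWord DPOp Z) : Prop :=
  u.size ≤ n ∧ v.size ≤ n ∧ DlexLT u v

/-- Letters embed into a lexicographic sum: variables first, then brackets ordered by operator (`D`
as 0, `P` as 1) and then by content. A content of size less than `n + 1` falls under the bound `n`.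
-/
theorem wellFounded_letterLT (hZ : WellFounded ((· < ·) : Z → Z → Prop)) {n : ℕ}
    (h : WellFounded (BoundedDlexLT n : OpWord DPOp Z → OpWord DPOp Z → Prop)) :
    WellFounded (LetterLT (n + 1) : OpLetter DPOp Z → OpLetter DPOp Z → Prop) := by
  have h2 := WellFounded.prod_lex (wellFounded_lt (α := ℕ)) h
  have h1 := Sum.lex_wf hZ h2
  let f : OpLetter DPOp Z → Z ⊕ (ℕ × OpWord DPOp Z) := fun a => match a with
    | .var z => .inl z
    | .br .D w => .inr (0, w)
    | .br .P w => .inr (1, w)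
  refine Subrelation.wf ?_ (InvImage.wf f h1)
  intro a b hab
  cases hab with
  | var_var h => exact Sum.Lex.inl h
  | var_br z ω t => cases ω <;> exact Sum.Lex.sep _ _
  | D_P s t => exact Sum.Lex.inr (Prod.Lex.left _ _ one_pos)
  | br_br ω hs ht h =>
    have : BoundedDlexLT n _ _ := ⟨Nat.lt_succ_iff.1 hs, Nat.lt_succ_iff.1 ht, h⟩
    cases ω <;> exact Sum.Lex.inr (Prod.Lex.right _ this)

/-- The bound is essential, since nesting brackets gives infinite descent in `DlexLT`. Brackets in a
word of size at most `n + 1` contain words of size at most `n`, so the induction passes from words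
to letters and back by shortlex. -/
theorem wellFounded_boundedDlexLT (hZ : WellFounded ((· < ·) : Z → Z → Prop)) (n : ℕ) :
    WellFounded (BoundedDlexLT n : OpWord DPOp Z → OpWord DPOp Z → Prop) := by
  induction n with
  | zero =>
    refine ⟨fun u => ⟨_, fun v h => ?_⟩⟩
    exact absurd h.1 (by have := size_pos v; omega)
  | succ n ih =>
    exact Subrelation.wf (fun h => shortlex_letters h.1 h.2.1 h.2.2)
      (InvImage.wf letters (List.Shortlex.wf (wellFounded_letterLT hZ ih)))

end Dlex

theorem dlexLT_trichotomous {Z : Type*} [LinearOrder Z] (u v : OpWord DPOp Z) :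
    DlexLT u v ∨ u = v ∨ DlexLT v u := by
  -- Lists of equal length agree or have a first position where they differ.
  have split : ∀ l l' : List (OpLetter DPOp Z), l.length = l'.length → l = l' ∨
      ∃ m a b n n', a ≠ b ∧ l = m ++ a :: n ∧ l' = m ++ b :: n' := by
    intro l
    induction l with
    | nil => intro l' h; left; exact (List.length_eq_zero_iff.1 h.symm).symm
    | cons a l ih =>
      intro l' h
      cases l' with
      | nil => simp at h
      | cons b l' =>
        by_cases hab : a = b
        · subst hab
          rcases ih l' (by simpa using h) with h | ⟨m, c, d, n, n', h, h1, h2⟩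
          · left; rw [h]
          · exact .inr ⟨a :: m, c, d, n, n', h, by simp [h1], by simp [h2]⟩
        · exact .inr ⟨[], a, b, l, l', hab, rfl, rfl⟩
  induction hn : u.size using Nat.strong_induction_on generalizing u v with
  | _ n ih =>
  rcases lt_trichotomy u.breadth v.breadth with h | h | h
  · exact .inl (.breadth h)
  · rcases split u.letters v.letters h with h' | ⟨m, a, b, n, n', hab, hu, hv⟩
    · exact .inr (.inl (letters_injective h'))
    · cases a with
      | var z =>
        cases b with
        | var z' =>
          rcases lt_trichotomy z z' with hz | hz | hz
          · exact .inl (.var_var h hu hv hz)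
          · exact absurd (congrArg _ hz) hab
          · exact .inr (.inr (.var_var h.symm hv hu hz))
        | br ω t => exact .inl (.var_br h hu hv)
      | br ω s =>
        cases b with
        | var z' => exact .inr (.inr (.var_br h.symm hv hu))
        | br ω' t =>
          by_cases hω : ω = ω'
          · subst hω
            rcases ih s.size (hn ▸ size_lt_of_mem_letters (ω := ω) (by simp [hu])) s t rfl with
              hs | hs | hs
            · exact .inl (.br_br h hu hv hs)
            · exact absurd (congrArg _ hs) hab
            · exact .inr (.inr (.br_br h.symm hv hu hs))
          · cases ω <;> cases ω'
            · exact absurd rfl hω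
            · exact .inl (.D_P h hu hv)
            · exact .inr (.inr (.D_P h.symm hv hu))
            · exact absurd rfl hω
  · exact .inr (.inr (.breadth h))

/-- The strict order `<_PD`. -/
def PDlt {Z : Type*} [LT Z] (u v : OpWord DPOp Z) : Prop :=
  u.degOp .D < v.degOp .D ∨ u.degOp .D = v.degOp .D ∧
  (u.degOp .P < v.degOp .P ∨ u.degOp .P = v.degOp .P ∧
  (u.degZ < v.degZ ∨ u.degZ = v.degZ ∧
  (u.degGD < v.degGD ∨ u.degGD = v.degGD ∧
  (u.degGP < v.degGP ∨ u.degGP = v.degGP ∧ DlexLT u v))))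

/-! ### The order `≤_PD`: well order and compatibility with the operations. -/

section PD

variable {Z : Type*}

theorem pdle_iff [LT Z] {u v : OpWord DPOp Z} : PDle u v ↔ PDlt u v ∨ u = v := by
  unfold PDle PDlt
  by_cases h : u = v
  · subst h; simp
  · simp [h]

theorem wellFounded_pdlt [LT Z] [WellFoundedLT Z] :
    WellFounded (PDlt : OpWord DPOp Z → OpWord DPOp Z → Prop) := by
  have hN := wellFounded_lt (α := ℕ)
  have hw (n : ℕ) := wellFounded_boundedDlexLT (Z := Z) wellFounded_lt n
  -- A descending chain here keeps its size, so the bounded order at that size controls it.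
  have hs : WellFounded (fun u v : OpWord DPOp Z => u.size = v.size ∧ DlexLT u v) := by
    refine ⟨fun u => ?_⟩
    have := (hw u.size).apply u
    generalize hn : u.size = n at this
    induction this with
    | intro u _ ih =>
      exact ⟨_, fun v hv => ih v ⟨(hv.1.trans hn).le, hn.le, hv.2⟩ (hv.1.trans hn)⟩
  have h := WellFounded.prod_lex hN (WellFounded.prod_lex hN (WellFounded.prod_lex hN (WellFounded.prod_lex hN (WellFounded.prod_lex hN hs))))
  refine Subrelation.wf ?_ (InvImage.wf (fun u : OpWord DPOp Z =>
    (u.degOp .D, u.degOp .P, u.degZ, u.degGD, u.degGP, u)) h)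
  intro u v huv
  simp only [InvImage, Prod.lex_def]
  rcases huv with h | ⟨h1, h | ⟨h2, h | ⟨h3, h | ⟨h4, h | ⟨h5, h⟩⟩⟩⟩⟩
  · exact .inl h
  · exact .inr ⟨h1, .inl h⟩
  · exact .inr ⟨h1, .inr ⟨h2, .inl h⟩⟩
  · exact .inr ⟨h1, .inr ⟨h2, .inr ⟨h3, .inl h⟩⟩⟩
  · exact .inr ⟨h1, .inr ⟨h2, .inr ⟨h3, .inr ⟨h4, .inl h⟩⟩⟩⟩
  · exact .inr ⟨h1, .inr ⟨h2, .inr ⟨h3, .inr ⟨h4, .inr ⟨h5, by simp [size_eq, h1, h2, h3], h⟩⟩⟩⟩⟩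

theorem pdlt_trichotomous [LinearOrder Z] (u v : OpWord DPOp Z) :
    PDlt u v ∨ u = v ∨ PDlt v u := by
  have := dlexLT_trichotomous u v
  unfold PDlt
  grind

/-- By trichotomy a failure would produce a cycle of length two or three, which well-foundedness
excludes; transitivity of `DlexLT` is never proved directly. -/
theorem PDlt.trans [LinearOrder Z] [WellFoundedLT Z] {u v w : OpWord DPOp Z}
    (h : PDlt u v) (h' : PDlt v w) : PDlt u w := by
  rcases pdlt_trichotomous u w with h'' | rfl | h''
  · exact h''
  · exact absurd h' (wellFounded_pdlt.asymmetric _ _ h)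
  · exact absurd h'' (wellFounded_pdlt.asymmetric₃ _ _ _ h h')

theorem PDlt.ne [LT Z] [WellFoundedLT Z] {u v : OpWord DPOp Z} (h : PDlt u v) : u ≠ v := by
  rintro rfl
  exact wellFounded_pdlt.asymmetric _ _ h h

theorem pdle_and_ne_iff [LT Z] [WellFoundedLT Z] {u v : OpWord DPOp Z} :
    PDle u v ∧ u ≠ v ↔ PDlt u v := by
  rw [pdle_iff]
  exact ⟨fun h => h.1.resolve_right h.2, fun h => ⟨.inl h, h.ne⟩⟩

theorem PDlt.br [LT Z] {u v : OpWord DPOp Z} (h : PDlt u v) (ω : DPOp) :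
    PDlt (br ω u) (br ω v) := by
  have := fun h : DlexLT u v => h.br ω
  unfold PDlt at *
  simp only [degOp_br, degZ_br, degGD_br, degGP_br]
  grind

/-- The GD- and GP-degree matter only once the three counts tie, and then the cross terms
contributed by `w` are the same on both sides. -/
theorem PDlt.mul_right [LT Z] {u v : OpWord DPOp Z} (h : PDlt u v) (w : OpWord DPOp Z) :
    PDlt (u * w) (v * w) := by
  have := fun h : DlexLT u v => h.mul_right w
  unfold PDlt at *
  simp only [degOp_mul, degZ_mul, degGD_mul, degGP_mul]
  grind

theorem PDlt.mul_left [LT Z] {u v : OpWord DPOp Z} (h : PDlt u v) (w : OpWord DPOp Z) :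
    PDlt (w * u) (w * v) := by
  have := fun h : DlexLT u v => h.mul_left w
  unfold PDlt at *
  simp only [degOp_mul, degZ_mul, degGD_mul, degGP_mul]
  grind

theorem isLinearOrder_pdle [LinearOrder Z] [WellFoundedLT Z] :
    IsLinearOrder (OpWord DPOp Z) PDle where
  refl u := pdle_iff.2 (.inr rfl)
  trans u v w h h' := by
    rw [pdle_iff] at *
    rcases h with h | rfl
    · rcases h' with h' | rfl
      · exact .inl (h.trans h')
      · exact .inl h
    · exact h'
  antisymm u v h h' := by
    rw [pdle_iff] at *
    rcases h with h | h
    · rcases h' with h' | h'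
      · exact absurd h' (wellFounded_pdlt.asymmetric _ _ h)
      · exact h'.symm
    · exact h
  total u v := by
    rw [pdle_iff, pdle_iff]
    rcases pdlt_trichotomous u v with h | h | h
    · exact .inl (.inl h)
    · exact .inl (.inr h)
    · exact .inr (.inl h)

/-- Every comparison needed for the identities is decided by breadth at the latest, so it reduces to
arithmetic of natural numbers. -/
theorem pdlt_of_degrees [LT Z] {u v : OpWord DPOp Z}
    (h : u.degOp .D < v.degOp .D ∨ u.degOp .D = v.degOp .D ∧
      (u.degOp .P < v.degOp .P ∨ u.degOp .P = v.degOp .P ∧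
      (u.degZ < v.degZ ∨ u.degZ = v.degZ ∧
      (u.degGD < v.degGD ∨ u.degGD = v.degGD ∧
      (u.degGP < v.degGP ∨ u.degGP = v.degGP ∧ u.breadth < v.breadth))))) : PDlt u v := by
  unfold PDlt
  have := fun h : u.breadth < v.breadth => DlexLT.breadth h
  tauto

end PD

/-! ### Words with a hole and substitution into it. -/

section Star

variable {Ω Z : Type*}

/-- The word `q` does not contain the symbol `⋆`. -/
def IsStarFree (q : OpWord Ω (Option Z)) : Prop :=
  q.varWeight (fun o => o.elim 1 (fun _ => 0)) = 0

theorem plug_mul (q r : OpWord Ω (Option Z)) (u : OpWord Ω Z) :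
    (q * r).plug u = q.plug u * r.plug u := by
  unfold plug
  induction q <;> simp_all [br_mul, var_mul, consBr_mul, consVar_mul, subst, mul_assoc]

@[simp] theorem plug_br (ω : Ω) (q : OpWord Ω (Option Z)) (u : OpWord Ω Z) :
    (br ω q).plug u = br ω (q.plug u) := rfl

@[simp] theorem plug_none (u : OpWord Ω Z) : (var none : OpWord Ω (Option Z)).plug u = u := rfl

@[simp] theorem plug_some (z : Z) (u : OpWord Ω Z) :
    (var (some z) : OpWord Ω (Option Z)).plug u = var z := rfl

theorem isStarWord_none : (var none : OpWord Ω (Option Z)).IsStarWord := rfl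

theorem isStarWord_mul {q r : OpWord Ω (Option Z)} :
    (q * r).IsStarWord ↔ q.IsStarWord ∧ r.IsStarFree ∨ q.IsStarFree ∧ r.IsStarWord := by
  unfold IsStarWord IsStarFree
  rw [varWeight_mul]
  omega

theorem isStarFree_mul {q r : OpWord Ω (Option Z)} :
    (q * r).IsStarFree ↔ q.IsStarFree ∧ r.IsStarFree := by
  unfold IsStarFree
  rw [varWeight_mul]
  omega

theorem not_isStarFree_none : ¬ (var none : OpWord Ω (Option Z)).IsStarFree := one_ne_zero

theorem not_isStarWord_some (z : Z) : ¬ (var (some z) : OpWord Ω (Option Z)).IsStarWord :=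
  zero_ne_one

/-- The word `u`, regarded as a word over `Z ∪ {⋆}`. -/
def const (u : OpWord Ω Z) : OpWord Ω (Option Z) := u.subst (fun z => var (some z))

theorem isStarFree_const (u : OpWord Ω Z) : u.const.IsStarFree := by
  unfold const
  induction u with
  | var z => rfl
  | br ω w ih => exact ih
  | consVar z v ih => exact isStarFree_mul.2 ⟨rfl, ih⟩
  | consBr ω w v ihw ihv => exact isStarFree_mul.2 ⟨ihw, ihv⟩

@[simp] theorem plug_const (u v : OpWord Ω Z) : u.const.plug v = u := by
  unfold const
  induction u with
  | var z => rfl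
  | br ω w ih => exact congrArg _ ih
  | consVar z u ih => exact (plug_mul _ _ _).trans (by rw [ih]; rfl)
  | consBr ω w u ihw ihu =>
    exact (plug_mul _ _ _).trans (by rw [ihu, plug_br, ihw]; rfl)

theorem IsStarFree.plug_eq {q : OpWord Ω (Option Z)} (hq : q.IsStarFree) (u v : OpWord Ω Z) :
    q.plug u = q.plug v := by
  induction q with
  | var o => cases o with
    | none => exact absurd hq not_isStarFree_none
    | some z => rfl
  | br ω w ih => exact congrArg (br ω) (ih hq)
  | consVar o q ih =>
    rw [← var_mul] at hq ⊢
    obtain ⟨h1, h2⟩ := isStarFree_mul.1 hq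
    rw [plug_mul, plug_mul, ih h2]
    cases o with
    | none => exact absurd h1 not_isStarFree_none
    | some z => rfl
  | consBr ω w q ihw ihq =>
    rw [← br_mul] at hq ⊢
    obtain ⟨h1, h2⟩ := isStarFree_mul.1 hq
    rw [plug_mul, plug_mul, ihq h2, plug_br, plug_br, ihw h1]

end Star

/-! ### Compatibility with contexts. -/

section Monomial

variable {Z : Type*}

/-- The single hole lies in one factor of a product; the other factor is star-free, hence unaffected
by the substitution, and acts as a fixed multiplier. -/
theorem PDlt.plug [LT Z] {u v : OpWord DPOp Z} (h : PDlt u v) {q : OpWord DPOp (Option Z)}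
    (hq : q.IsStarWord) : PDlt (q.plug u) (q.plug v) := by
  induction q with
  | var o => cases o with
    | none => exact h
    | some z => exact absurd hq (not_isStarWord_some z)
  | br ω w ih => exact (ih hq).br ω
  | consVar o q ih =>
    rw [← var_mul] at hq ⊢
    rw [plug_mul, plug_mul]
    rcases isStarWord_mul.1 hq with ⟨h1, h2⟩ | ⟨h1, h2⟩
    · cases o with
      | none => rw [h2.plug_eq u v]; exact h.mul_right _
      | some z => exact absurd h1 (not_isStarWord_some z)
    · rw [h1.plug_eq u v]; exact (ih h2).mul_left _
  | consBr ω w q ihw ihq =>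
    rw [← br_mul] at hq ⊢
    rw [plug_mul, plug_mul]
    rcases isStarWord_mul.1 hq with ⟨h1, h2⟩ | ⟨h1, h2⟩
    · rw [h2.plug_eq u v]; exact ((ihw h1).br ω).mul_right _
    · rw [h1.plug_eq u v]; exact (ihq h2).mul_left _

theorem isMonomialOrder_pdle [LinearOrder Z] [WellFoundedLT Z] :
    IsMonomialOrder (PDle : OpWord DPOp Z → OpWord DPOp Z → Prop) where
  linear := isLinearOrder_pdle
  wf := by simpa only [pdle_and_ne_iff] using wellFounded_pdlt
  compat q u v hq h hne := pdle_and_ne_iff.2 ((pdle_and_ne_iff.1 ⟨h, hne⟩).plug hq)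

end Monomial

end OpWord

/-! ### The identities as bilinear and linear maps on the semigroup algebra. -/

namespace DRB

open OpWord

variable {k : Type*} [Field k] {Z : Type*}

/-- The word `u` as an element of the semigroup algebra. -/
noncomputable def word {Ω : Type*} (u : OpWord Ω Z) : MonoidAlgebra k (OpWord Ω Z) :=
  MonoidAlgebra.single u 1

/-- The operator `⌊ ⌋_ω` as a linear map. -/
noncomputable def opL (ω : DPOp) :
    MonoidAlgebra k (OpWord DPOp Z) →ₗ[k] MonoidAlgebra k (OpWord DPOp Z) :=
  MonoidAlgebra.mapDomainLinearMap k k (OpWord.br ω)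

theorem word_br (ω : DPOp) (u : OpWord DPOp Z) : (word (br ω u) : MonoidAlgebra k _) =
    opL ω (word u) := by
  simp [opL, word]

theorem word_mul {Ω : Type*} (u v : OpWord Ω Z) : (word (u * v) : MonoidAlgebra k _) =
    word u * word v := by
  simp [word, MonoidAlgebra.single_mul_single]

/-- The right-hand side of the rewriting rule with left-hand side `⌊a⌋_A ⌊b⌋_B`. -/
noncomputable def tailFun (lam : k) : DPOp → DPOp → MonoidAlgebra k (OpWord DPOp Z) →
    MonoidAlgebra k (OpWord DPOp Z) → MonoidAlgebra k (OpWord DPOp Z)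
  | .P, .P, a, b => opL .P (a * opL .P b) + opL .P (opL .P a * b) + lam • opL .P (a * b)
  | .D, .D, a, b => lam⁻¹ • opL .D (a * b) - lam⁻¹ • (opL .D a * b) - lam⁻¹ • (a * opL .D b)
  | .P, .D, a, b => opL .D (opL .P a * b) - a * b - lam • (a * opL .D b)
  | .D, .P, a, b => opL .D (a * opL .P b) - a * b - lam • (opL .D a * b)

/-- `tailFun` as a bilinear map. -/
noncomputable def tail (lam : k) (A B : DPOp) : MonoidAlgebra k (OpWord DPOp Z) →ₗ[k]
    MonoidAlgebra k (OpWord DPOp Z) →ₗ[k] MonoidAlgebra k (OpWord DPOp Z) :=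
  LinearMap.mk₂ k (tailFun lam A B)
    (fun a a' b => by
      cases A <;> cases B <;> simp only [tailFun, map_add, add_mul] <;> module)
    (fun c a b => by
      cases A <;> cases B <;> simp only [tailFun, map_smul, smul_mul_assoc] <;> module)
    (fun a b b' => by
      cases A <;> cases B <;> simp only [tailFun, map_add, mul_add] <;> module)
    (fun c a b => by
      cases A <;> cases B <;> simp only [tailFun, map_smul, mul_smul_comm] <;> module)

/-- The bilinear map `(a, b) ↦ φ(a, b)` for the identity `φ` with leading term `⌊x⌋_A ⌊y⌋_B`. -/
noncomputable def pair (lam : k) (A B : DPOp) (a b : MonoidAlgebra k (OpWord DPOp Z)) :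
    MonoidAlgebra k (OpWord DPOp Z) :=
  opL A a * opL B b - tail lam A B a b

/-- The linear map `a ↦ φ₃(a)`. -/
noncomputable def cancel (a : MonoidAlgebra k (OpWord DPOp Z)) : MonoidAlgebra k (OpWord DPOp Z) :=
  opL .D (opL .P a) - a

/-! ### Explicit formulas for the compositions. -/

section Identities

set_option linter.unusedSimpArgs false

variable {lam : k} (hlam : lam ≠ 0) (a b c : MonoidAlgebra k (OpWord DPOp Z))

theorem pair_PP (lam : k) : pair lam .P .P a b = opL .P a * opL .P b -
    (opL .P (a * opL .P b) + opL .P (opL .P a * b) + lam • opL .P (a * b)) := rfl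

theorem pair_DD (lam : k) : pair lam .D .D a b = opL .D a * opL .D b -
    (lam⁻¹ • opL .D (a * b) - lam⁻¹ • (opL .D a * b) - lam⁻¹ • (a * opL .D b)) := rfl

theorem pair_PD (lam : k) : pair lam .P .D a b = opL .P a * opL .D b -
    (opL .D (opL .P a * b) - a * b - lam • (a * opL .D b)) := rfl

theorem pair_DP (lam : k) : pair lam .D .P a b = opL .D a * opL .P b -
    (opL .D (a * opL .P b) - a * b - lam • (opL .D a * b)) := rfl

/-- This and the next seven formulas resolve the two ways to rewrite `⌊a⌋_A ⌊b⌋_B ⌊c⌋_C`. The terms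
on the right record the reductions that bring both results to a common form. Being multilinear, the
formulas hold for all elements; those that mix `lam` with `lam⁻¹` need `lam ≠ 0`. -/
theorem composition_PPP (lam : k) :
    pair lam .P .P a b * opL .P c - opL .P a * pair lam .P .P b c =
      pair lam .P .P a (b * opL .P c) + pair lam .P .P a (opL .P b * c) +
      lam • pair lam .P .P a (b * c) - pair lam .P .P (a * opL .P b) c -
      pair lam .P .P (opL .P a * b) c - lam • pair lam .P .P (a * b) c -
      opL .P (a * pair lam .P .P b c) + opL .P (pair lam .P .P a b * c) := by
  simp only [pair_PP, mul_add, add_mul, sub_mul, mul_sub, map_add, map_sub, map_smul,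
    smul_mul_assoc, mul_smul_comm, mul_assoc]
  module

theorem composition_PPD (lam : k) :
    pair lam .P .P a b * opL .D c - opL .P a * pair lam .P .D b c =
      pair lam .P .D a (opL .P b * c) - pair lam .P .D (a * opL .P b) c -
      pair lam .P .D (opL .P a * b) c - lam • pair lam .P .D (a * b) c +
      opL .D (pair lam .P .P a b * c) + lam • (a * pair lam .P .D b c) := by
  simp only [pair_PP, pair_PD, mul_add, add_mul, sub_mul, mul_sub, map_add, map_sub, map_smul,
    smul_mul_assoc, mul_smul_comm, mul_assoc]
  module

theorem composition_PDP (lam : k) :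
    pair lam .P .D a b * opL .P c - opL .P a * pair lam .D .P b c =
      pair lam .P .D a (b * opL .P c) - pair lam .D .P (opL .P a * b) c +
      lam • (a * pair lam .D .P b c) - lam • (pair lam .P .D a b * c) := by
  simp only [pair_DP, pair_PD, mul_add, add_mul, sub_mul, mul_sub, map_add, map_sub, map_smul,
    smul_mul_assoc, mul_smul_comm, mul_assoc]
  module

include hlam in
theorem composition_PDD :
    pair lam .P .D a b * opL .D c - opL .P a * pair lam .D .D b c =
      lam • (a * pair lam .D .D b c) - pair lam .D .D (opL .P a * b) c -
      lam⁻¹ • (pair lam .P .D a b * c) + lam⁻¹ • pair lam .P .D a (b * c) := by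
  simp only [pair_DD, pair_PD, mul_add, add_mul, sub_mul, mul_sub, map_add, map_sub, map_smul,
    smul_mul_assoc, mul_smul_comm, mul_assoc]
  match_scalars <;> field_simp <;> ring

theorem composition_DPP (lam : k) :
    pair lam .D .P a b * opL .P c - opL .D a * pair lam .P .P b c =
      pair lam .D .P a (b * opL .P c) + pair lam .D .P a (opL .P b * c) +
      lam • pair lam .D .P a (b * c) - pair lam .D .P (a * opL .P b) c -
      opL .D (a * pair lam .P .P b c) - lam • (pair lam .D .P a b * c) := by
  simp only [pair_PP, pair_DP, mul_add, add_mul, sub_mul, mul_sub, map_add, map_sub, map_smul,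
    smul_mul_assoc, mul_smul_comm, mul_assoc]
  module

include hlam in
theorem composition_DPD :
    pair lam .D .P a b * opL .D c - opL .D a * pair lam .P .D b c =
      pair lam .D .D a (opL .P b * c) - pair lam .D .D (a * opL .P b) c +
      lam⁻¹ • (a * pair lam .P .D b c) - lam⁻¹ • (pair lam .D .P a b * c) := by
  simp only [pair_DD, pair_DP, pair_PD, mul_add, add_mul, sub_mul, mul_sub, map_add, map_sub,
    map_smul, smul_mul_assoc, mul_smul_comm, mul_assoc]
  match_scalars <;> field_simp <;> ring

include hlam in
theorem composition_DDP :
    pair lam .D .D a b * opL .P c - opL .D a * pair lam .D .P b c =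
      lam⁻¹ • (a * pair lam .D .P b c) - lam⁻¹ • pair lam .D .P (a * b) c +
      pair lam .D .D a (b * opL .P c) - lam • (pair lam .D .D a b * c) := by
  simp only [pair_DD, pair_DP, mul_add, add_mul, sub_mul, mul_sub, map_add, map_sub, map_smul,
    smul_mul_assoc, mul_smul_comm, mul_assoc]
  match_scalars <;> field_simp <;> ring

theorem composition_DDD (lam : k) :
    pair lam .D .D a b * opL .D c - opL .D a * pair lam .D .D b c =
      lam⁻¹ • (a * pair lam .D .D b c) - lam⁻¹ • pair lam .D .D (a * b) c -
      lam⁻¹ • (pair lam .D .D a b * c) + lam⁻¹ • pair lam .D .D a (b * c) := by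
  simp only [pair_DD, mul_add, add_mul, sub_mul, mul_sub, map_add, map_sub, map_smul,
    smul_mul_assoc, mul_smul_comm, mul_assoc]
  module

include hlam in
-- Read backwards, this shows that `φ₄` is a consequence of `φ₂` and `φ₃`: it is what their
-- composition leaves over. The mirror formula does the same for `φ₅`.
theorem composition_cancel_D :
    pair lam .D .D (opL .P a) b - cancel a * opL .D b =
      lam⁻¹ • (cancel a * b) + lam⁻¹ • pair lam .P .D a b := by
  simp only [pair_DD, pair_PD, cancel, mul_add, add_mul, sub_mul, mul_sub, map_add, map_sub,
    map_smul, smul_mul_assoc, mul_smul_comm, mul_assoc]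
  match_scalars <;> field_simp <;> ring

include hlam in
theorem composition_D_cancel :
    pair lam .D .D a (opL .P b) - opL .D a * cancel b =
      lam⁻¹ • (a * cancel b) + lam⁻¹ • pair lam .D .P a b := by
  simp only [pair_DD, pair_DP, cancel, mul_add, add_mul, sub_mul, mul_sub, map_add, map_sub,
    map_smul, smul_mul_assoc, mul_smul_comm, mul_assoc]
  match_scalars <;> field_simp <;> ring

theorem composition_cancel_P (lam : k) :
    pair lam .D .P (opL .P a) b - cancel a * opL .P b =
      lam • (cancel a * b) - opL .D (pair lam .P .P a b) - cancel (a * opL .P b) -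
      cancel (opL .P a * b) - lam • cancel (a * b) := by
  simp only [pair_PP, pair_DP, cancel, mul_add, add_mul, sub_mul, mul_sub, map_add, map_sub,
    map_smul, smul_mul_assoc, mul_smul_comm, mul_assoc]
  module

theorem composition_P_cancel (lam : k) :
    pair lam .P .D a (opL .P b) - opL .P a * cancel b =
      lam • (a * cancel b) - opL .D (pair lam .P .P a b) - cancel (a * opL .P b) -
      cancel (opL .P a * b) - lam • cancel (a * b) := by
  simp only [pair_PP, pair_PD, cancel, mul_add, add_mul, sub_mul, mul_sub, map_add, map_sub,
    map_smul, smul_mul_assoc, mul_smul_comm, mul_assoc]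
  module

end Identities

end DRB

/-! ### Instances of the identities as rewriting rules. -/

namespace DRB

open OpWord

variable {k : Type*} [Field k] {Z : Type*}

/-- The rewriting rules `m ↦ r` given by the instances `m - r` of the identities. -/
inductive IsRule (lam : k) : OpWord DPOp Z → MonoidAlgebra k (OpWord DPOp Z) → Prop
  | pair (A B : DPOp) (u v : OpWord DPOp Z) :
      IsRule lam (br A u * br B v) (tail lam A B (word u) (word v))
  | cancel (u : OpWord DPOp Z) : IsRule lam (br .D (br .P u)) (word u)

theorem subst_mul {Ω Y : Type*} (σ : Y → OpWord Ω Z) (u v : OpWord Ω Y) :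
    (u * v).subst σ = u.subst σ * v.subst σ := by
  induction u <;>
    simp_all [OpWord.br_mul, OpWord.var_mul, consBr_mul, consVar_mul, OpWord.subst, mul_assoc]

set_option linter.unusedSimpArgs false in
theorem mem_opiInstances_iff {lam : k} {f : MonoidAlgebra k (OpWord DPOp Z)} :
    f ∈ opiInstances (dRB lam) (Set.univ : Set (OpWord DPOp Z)) ↔
      ∃ m r, IsRule lam m r ∧ f = word m - r := by
  have hL (σ : OPIVar → OpWord DPOp Z) (g : MonoidAlgebra k (OpWord DPOp OPIVar)) :
      MonoidAlgebra.mapDomain (OpWord.subst σ) g =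
        MonoidAlgebra.mapDomainLinearMap k k (OpWord.subst σ) g := rfl
  have hw (σ : OPIVar → OpWord DPOp Z) (u : OpWord DPOp OPIVar) :
      MonoidAlgebra.mapDomainLinearMap k k (OpWord.subst σ) (word u) = word (u.subst σ) := by
    simp [word]
  have hx : (x : MonoidAlgebra k _) = word (.var .x) := rfl
  have hy : (y : MonoidAlgebra k _) = word (.var .y) := rfl
  have hD (u : OpWord DPOp OPIVar) : D (word u : MonoidAlgebra k _) = word (br .D u) := by
    simp [D, word]
  have hP (u : OpWord DPOp OPIVar) : P (word u : MonoidAlgebra k _) = word (br .P u) := by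
    simp [P, word]
  have h1 (σ : OPIVar → OpWord DPOp Z) : MonoidAlgebra.mapDomain (OpWord.subst σ) (φ₁ lam) =
      pair lam .P .P (word (σ .x)) (word (σ .y)) := by
    simp only [hL, φ₁, hx, hy, hD, hP, ← word_mul, map_sub, map_smul, hw, subst_mul, OpWord.subst,
      pair_PP, ← word_br]
    module
  have h2 (σ : OPIVar → OpWord DPOp Z) : MonoidAlgebra.mapDomain (OpWord.subst σ) (φ₂ lam) =
      pair lam .D .D (word (σ .x)) (word (σ .y)) := by
    simp only [hL, φ₂, hx, hy, hD, hP, ← word_mul, map_sub, map_add, map_smul, hw, subst_mul,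
      OpWord.subst, pair_DD, ← word_br]
    module
  have h3 (σ : OPIVar → OpWord DPOp Z) :
      MonoidAlgebra.mapDomain (OpWord.subst σ) (φ₃ : MonoidAlgebra k _) = cancel (word (σ .x)) := by
    simp only [hL, φ₃, hx, hD, hP, map_sub, hw, OpWord.subst, cancel, ← word_br]
  have h4 (σ : OPIVar → OpWord DPOp Z) : MonoidAlgebra.mapDomain (OpWord.subst σ) (φ₄ lam) =
      pair lam .P .D (word (σ .x)) (word (σ .y)) := by
    simp only [hL, φ₄, hx, hy, hD, hP, ← word_mul, map_sub, map_add, map_smul, hw, subst_mul,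
      OpWord.subst, pair_PD, ← word_br]
    module
  have h5 (σ : OPIVar → OpWord DPOp Z) : MonoidAlgebra.mapDomain (OpWord.subst σ) (φ₅ lam) =
      pair lam .D .P (word (σ .x)) (word (σ .y)) := by
    simp only [hL, φ₅, hx, hy, hD, hP, ← word_mul, map_sub, map_add, map_smul, hw, subst_mul,
      OpWord.subst, pair_DP, ← word_br]
    module
  have hpair (A B : DPOp) (u v : OpWord DPOp Z) : pair lam A B (word u) (word v) =
      word (br A u * br B v) - tail lam A B (word u) (word v) := by
    rw [word_mul, word_br, word_br]; rfl
  have hcancel (u : OpWord DPOp Z) :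
      (cancel (word u) : MonoidAlgebra k _) = word (br .D (br .P u)) - word u := by
    rw [word_br, word_br]; rfl
  constructor
  · rintro ⟨φ, hφ, σ, -, rfl⟩
    rcases hφ with rfl | rfl | rfl | rfl | rfl
    · exact ⟨_, _, .pair _ _ _ _, (h1 σ).trans (hpair _ _ _ _)⟩
    · exact ⟨_, _, .pair _ _ _ _, (h2 σ).trans (hpair _ _ _ _)⟩
    · exact ⟨_, _, .cancel _, (h3 σ).trans (hcancel _)⟩
    · exact ⟨_, _, .pair _ _ _ _, (h4 σ).trans (hpair _ _ _ _)⟩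
    · exact ⟨_, _, .pair _ _ _ _, (h5 σ).trans (hpair _ _ _ _)⟩
  · rintro ⟨m, r, hr, rfl⟩
    cases hr with
    | pair A B u v =>
      let σ : OPIVar → OpWord DPOp Z := fun i => match i with
        | .x => u
        | .y => v
      rw [← hpair]
      cases A <;> cases B
      · exact ⟨φ₂ lam, by simp [dRB], σ, fun _ => trivial, (h2 σ).symm⟩
      · exact ⟨φ₅ lam, by simp [dRB], σ, fun _ => trivial, (h5 σ).symm⟩
      · exact ⟨φ₄ lam, by simp [dRB], σ, fun _ => trivial, (h4 σ).symm⟩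
      · exact ⟨φ₁ lam, by simp [dRB], σ, fun _ => trivial, (h1 σ).symm⟩
    | cancel u =>
      rw [← hcancel]
      exact ⟨φ₃, by simp [dRB], fun _ => u, fun _ => Set.mem_univ _, (h3 fun _ => u).symm⟩

/-! ### Spans of elements attached to words below a bound. -/

section Graded

set_option linter.unusedSectionVars false
set_option linter.unusedSimpArgs false

variable [LinearOrder Z] [WellFoundedLT Z]

/-- A family of elements attached to words that is stable under the operators and under
multiplication by words on either side. -/
structure IsStable (E : OpWord DPOp Z → MonoidAlgebra k (OpWord DPOp Z) → Prop) : Prop where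
  op : ∀ {m h}, E m h → ∀ ω, E (br ω m) (opL ω h)
  mul_right : ∀ {m h}, E m h → ∀ w, E (m * w) (h * word w)
  mul_left : ∀ {m h}, E m h → ∀ w, E (w * m) (word w * h)

/-- The span of the elements of the family `E` attached to words less than `p`. -/
noncomputable def below (E : OpWord DPOp Z → MonoidAlgebra k (OpWord DPOp Z) → Prop) (p : OpWord DPOp Z) :
    Submodule k (MonoidAlgebra k (OpWord DPOp Z)) :=
  Submodule.span k {h | ∃ m, E m h ∧ PDlt m p}

/-- The span of the elements of the family `E` attached to words less than or equal to `p`. -/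
noncomputable def upTo (E : OpWord DPOp Z → MonoidAlgebra k (OpWord DPOp Z) → Prop) (p : OpWord DPOp Z) :
    Submodule k (MonoidAlgebra k (OpWord DPOp Z)) :=
  Submodule.span k {h | ∃ m, E m h ∧ (PDlt m p ∨ m = p)}

variable {E : OpWord DPOp Z → MonoidAlgebra k (OpWord DPOp Z) → Prop} {p p' : OpWord DPOp Z}
  {h : MonoidAlgebra k (OpWord DPOp Z)}

theorem mem_upTo (hm : E p h) : h ∈ upTo E p := Submodule.subset_span ⟨p, hm, .inr rfl⟩

theorem mem_below_of_mem_upTo (hp : PDlt p' p) (hm : h ∈ upTo E p') : h ∈ below E p := by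
  refine Submodule.span_mono ?_ hm
  rintro h ⟨m, hE, hmp | rfl⟩
  · exact ⟨m, hE, hmp.trans hp⟩
  · exact ⟨m, hE, hp⟩

theorem upTo_map {E' : OpWord DPOp Z → MonoidAlgebra k (OpWord DPOp Z) → Prop}
    (L : MonoidAlgebra k (OpWord DPOp Z) →ₗ[k] MonoidAlgebra k (OpWord DPOp Z))
    (l : OpWord DPOp Z → OpWord DPOp Z) (hl : ∀ {u v}, PDlt u v → PDlt (l u) (l v))
    (hE : ∀ {m h}, E m h → E' (l m) (L h)) (hm : h ∈ upTo E p) : L h ∈ upTo E' (l p) := by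
  have : upTo E p ≤ (upTo E' (l p)).comap L := by
    refine Submodule.span_le.2 ?_
    rintro h ⟨m, hm, hmp⟩
    exact Submodule.subset_span ⟨l m, hE hm, hmp.imp hl (congrArg l)⟩
  exact this hm

theorem below_map {E' : OpWord DPOp Z → MonoidAlgebra k (OpWord DPOp Z) → Prop}
    (L : MonoidAlgebra k (OpWord DPOp Z) →ₗ[k] MonoidAlgebra k (OpWord DPOp Z))
    (l : OpWord DPOp Z → OpWord DPOp Z) (hl : ∀ {u v}, PDlt u v → PDlt (l u) (l v))
    (hE : ∀ {m h}, E m h → E' (l m) (L h)) (hm : h ∈ below E p) : L h ∈ below E' (l p) := by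
  have : below E p ≤ (below E' (l p)).comap L := by
    refine Submodule.span_le.2 ?_
    rintro h ⟨m, hm, hmp⟩
    exact Submodule.subset_span ⟨l m, hE hm, hl hmp⟩
  exact this hm

namespace IsStable

variable (hE : IsStable E)
include hE

theorem op_mem (hm : h ∈ upTo E p) (ω : DPOp) : opL ω h ∈ upTo E (br ω p) :=
  upTo_map (opL ω) (br ω) (fun h => h.br ω) (fun h => hE.op h ω) hm

theorem mul_right_mem (hm : h ∈ upTo E p) (w : OpWord DPOp Z) : h * word w ∈ upTo E (p * w) :=
  upTo_map (LinearMap.mulRight k (word w)) (· * w) (fun h => h.mul_right w)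
    (fun h => hE.mul_right h w) hm

theorem mul_left_mem (hm : h ∈ upTo E p) (w : OpWord DPOp Z) : word w * h ∈ upTo E (w * p) :=
  upTo_map (LinearMap.mulLeft k (word w)) (w * ·) (fun h => h.mul_left w)
    (fun h => hE.mul_left h w) hm

/-- Most terms of the tail lose an operator. The others are decided as follows: `P(uP(v))` and
`P(P(u)v)` drop in GP-degree, `D(uP(v))` drops in GD-degree because its `⌋_D` moves to the right,
and `D(P(u)v)` ties in all degrees but has breadth 1 instead of 2. The strict drops use that words
contain a variable. -/
theorem tail_left_mem (lam : k) (A B : DPOp) {u : OpWord DPOp Z} (hm : h ∈ upTo E u)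
    (v : OpWord DPOp Z) : tail lam A B h (word v) ∈ below E (br A u * br B v) := by
  have hu := degZ_pos u
  have hv := degZ_pos v
  have h1 := fun ω => hE.op_mem (hE.mul_right_mem hm v) ω
  have h2 := fun ω ω' => hE.op_mem (hE.mul_right_mem hm (br ω v)) ω'
  have h3 := fun ω ω' => hE.op_mem (hE.mul_right_mem (hE.op_mem hm ω) v) ω'
  have h4 := hE.mul_right_mem hm v
  have h5 := fun ω => hE.mul_right_mem hm (br ω v)
  have h6 := fun ω => hE.mul_right_mem (hE.op_mem hm ω) v
  simp only [word_br] at h2 h5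
  cases A <;> cases B
  · refine sub_mem (sub_mem (Submodule.smul_mem _ _ (mem_below_of_mem_upTo ?_ (h1 _)))
      (Submodule.smul_mem _ _ (mem_below_of_mem_upTo ?_ (h6 _))))
      (Submodule.smul_mem _ _ (mem_below_of_mem_upTo ?_ (h5 _))) <;>
    · refine pdlt_of_degrees ?_
      simp only [degOp_br, degOp_mul, degZ_br, degZ_mul, degGD_br, degGD_mul, degGP_br, degGP_mul,
        breadth_br, breadth_mul, eq_self, if_true, reduceCtorEq, if_false, mul_add, add_mul]
      grind
  · refine sub_mem (sub_mem (mem_below_of_mem_upTo ?_ (h2 _ _)) (mem_below_of_mem_upTo ?_ h4))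
      (Submodule.smul_mem _ _ (mem_below_of_mem_upTo ?_ (h6 _))) <;>
    · refine pdlt_of_degrees ?_
      simp only [degOp_br, degOp_mul, degZ_br, degZ_mul, degGD_br, degGD_mul, degGP_br, degGP_mul,
        breadth_br, breadth_mul, eq_self, if_true, reduceCtorEq, if_false, mul_add, add_mul]
      grind
  · refine sub_mem (sub_mem (mem_below_of_mem_upTo ?_ (h3 _ _)) (mem_below_of_mem_upTo ?_ h4))
      (Submodule.smul_mem _ _ (mem_below_of_mem_upTo ?_ (h5 _))) <;>
    · refine pdlt_of_degrees ?_
      simp only [degOp_br, degOp_mul, degZ_br, degZ_mul, degGD_br, degGD_mul, degGP_br, degGP_mul,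
        breadth_br, breadth_mul, eq_self, if_true, reduceCtorEq, if_false, mul_add, add_mul]
      grind
  · refine add_mem (add_mem (mem_below_of_mem_upTo ?_ (h2 _ _)) (mem_below_of_mem_upTo ?_ (h3 _ _)))
      (Submodule.smul_mem _ _ (mem_below_of_mem_upTo ?_ (h1 _))) <;>
    · refine pdlt_of_degrees ?_
      simp only [degOp_br, degOp_mul, degZ_br, degZ_mul, degGD_br, degGD_mul, degGP_br, degGP_mul,
        breadth_br, breadth_mul, eq_self, if_true, reduceCtorEq, if_false, mul_add, add_mul]
      grind

theorem tail_right_mem (lam : k) (A B : DPOp) {v : OpWord DPOp Z} (hm : h ∈ upTo E v)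
    (u : OpWord DPOp Z) : tail lam A B (word u) h ∈ below E (br A u * br B v) := by
  have hu := degZ_pos u
  have hv := degZ_pos v
  have h1 := fun ω => hE.op_mem (hE.mul_left_mem hm u) ω
  have h2 := fun ω ω' => hE.op_mem (hE.mul_left_mem (hE.op_mem hm ω) u) ω'
  have h3 := fun ω ω' => hE.op_mem (hE.mul_left_mem hm (br ω u)) ω'
  have h4 := hE.mul_left_mem hm u
  have h5 := fun ω => hE.mul_left_mem (hE.op_mem hm ω) u
  have h6 := fun ω => hE.mul_left_mem hm (br ω u)
  simp only [word_br] at h3 h6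
  cases A <;> cases B
  · refine sub_mem (sub_mem (Submodule.smul_mem _ _ (mem_below_of_mem_upTo ?_ (h1 _)))
      (Submodule.smul_mem _ _ (mem_below_of_mem_upTo ?_ (h6 _))))
      (Submodule.smul_mem _ _ (mem_below_of_mem_upTo ?_ (h5 _))) <;>
    · refine pdlt_of_degrees ?_
      simp only [degOp_br, degOp_mul, degZ_br, degZ_mul, degGD_br, degGD_mul, degGP_br, degGP_mul,
        breadth_br, breadth_mul, eq_self, if_true, reduceCtorEq, if_false, mul_add, add_mul]
      grind
  · refine sub_mem (sub_mem (mem_below_of_mem_upTo ?_ (h2 _ _)) (mem_below_of_mem_upTo ?_ h4))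
      (Submodule.smul_mem _ _ (mem_below_of_mem_upTo ?_ (h6 _))) <;>
    · refine pdlt_of_degrees ?_
      simp only [degOp_br, degOp_mul, degZ_br, degZ_mul, degGD_br, degGD_mul, degGP_br, degGP_mul,
        breadth_br, breadth_mul, eq_self, if_true, reduceCtorEq, if_false, mul_add, add_mul]
      grind
  · refine sub_mem (sub_mem (mem_below_of_mem_upTo ?_ (h3 _ _)) (mem_below_of_mem_upTo ?_ h4))
      (Submodule.smul_mem _ _ (mem_below_of_mem_upTo ?_ (h5 _))) <;>
    · refine pdlt_of_degrees ?_
      simp only [degOp_br, degOp_mul, degZ_br, degZ_mul, degGD_br, degGD_mul, degGP_br, degGP_mul,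
        breadth_br, breadth_mul, eq_self, if_true, reduceCtorEq, if_false, mul_add, add_mul]
      grind
  · refine add_mem (add_mem (mem_below_of_mem_upTo ?_ (h2 _ _)) (mem_below_of_mem_upTo ?_ (h3 _ _)))
      (Submodule.smul_mem _ _ (mem_below_of_mem_upTo ?_ (h1 _))) <;>
    · refine pdlt_of_degrees ?_
      simp only [degOp_br, degOp_mul, degZ_br, degZ_mul, degGD_br, degGD_mul, degGP_br, degGP_mul,
        breadth_br, breadth_mul, eq_self, if_true, reduceCtorEq, if_false, mul_add, add_mul]
      grind

end IsStable

/-- The family of all words. -/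
def IsWord (m : OpWord DPOp Z) (h : MonoidAlgebra k (OpWord DPOp Z)) : Prop := h = word m

theorem isStable_isWord : IsStable (IsWord (k := k) (Z := Z)) where
  op := by rintro m h rfl ω; exact (word_br ω m).symm
  mul_right := by rintro m h rfl w; exact (word_mul m w).symm
  mul_left := by rintro m h rfl w; exact (word_mul w m).symm

/-- The family of all instances of the identities in contexts. -/
def IsContext (lam : k) (m : OpWord DPOp Z) (h : MonoidAlgebra k (OpWord DPOp Z)) : Prop :=
  ∃ (q : OpWord DPOp (Option Z)) (n : OpWord DPOp Z) (r : MonoidAlgebra k (OpWord DPOp Z)),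
    q.IsStarWord ∧ IsRule lam n r ∧ m = q.plug n ∧ h = q.plugLin (word n - r)

/-- `OpWord.plugLin` as a linear map. -/
noncomputable def plugL (q : OpWord DPOp (Option Z)) :
    MonoidAlgebra k (OpWord DPOp Z) →ₗ[k] MonoidAlgebra k (OpWord DPOp Z) :=
  MonoidAlgebra.mapDomainLinearMap k k q.plug

theorem plugL_word (q : OpWord DPOp (Option Z)) (u : OpWord DPOp Z) :
    plugL q (word u) = (word (q.plug u) : MonoidAlgebra k _) := by
  simp [plugL, word]

theorem linearMap_ext {L L' : MonoidAlgebra k (OpWord DPOp Z) →ₗ[k]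
    MonoidAlgebra k (OpWord DPOp Z)} (h : ∀ u, L (word u) = L' (word u)) : L = L' := by
  refine MonoidAlgebra.lhom_ext' fun u => LinearMap.ext_ring ?_
  exact h u

theorem plugL_none (s : MonoidAlgebra k (OpWord DPOp Z)) : plugL (var none) s = s := by
  have : plugL (k := k) (Z := Z) (var none) = LinearMap.id :=
    linearMap_ext fun u => by rw [plugL_word]; rfl
  rw [this]; rfl

theorem plugL_br (ω : DPOp) (q : OpWord DPOp (Option Z)) (s : MonoidAlgebra k (OpWord DPOp Z)) :
    plugL (br ω q) s = opL ω (plugL q s) := by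
  have : plugL (k := k) (br ω q) = opL ω ∘ₗ plugL q :=
    linearMap_ext fun u => by rw [plugL_word, plug_br, word_br, LinearMap.comp_apply, plugL_word]
  rw [this]; rfl

theorem plugL_mul_left {q r : OpWord DPOp (Option Z)} {w : OpWord DPOp Z}
    (hq : ∀ u, q.plug u = w) (s : MonoidAlgebra k (OpWord DPOp Z)) :
    plugL (q * r) s = word w * plugL r s := by
  have : plugL (k := k) (q * r) = LinearMap.mulLeft k (word w) ∘ₗ plugL r :=
    linearMap_ext fun u => by
      rw [plugL_word, plug_mul, hq, word_mul, LinearMap.comp_apply, plugL_word]; rfl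
  rw [this]; rfl

theorem plugL_mul_right {q r : OpWord DPOp (Option Z)} {w : OpWord DPOp Z}
    (hr : ∀ u, r.plug u = w) (s : MonoidAlgebra k (OpWord DPOp Z)) :
    plugL (q * r) s = plugL q s * word w := by
  have : plugL (k := k) (q * r) = LinearMap.mulRight k (word w) ∘ₗ plugL q :=
    linearMap_ext fun u => by
      rw [plugL_word, plug_mul, hr, word_mul, LinearMap.comp_apply, plugL_word]; rfl
  rw [this]; rfl

theorem isStable_isContext (lam : k) : IsStable (IsContext (Z := Z) lam) where
  op := by
    rintro m h ⟨q, n, r, hq, hr, rfl, rfl⟩ ω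
    exact ⟨br ω q, n, r, hq, hr, rfl, (plugL_br ω q _).symm⟩
  mul_right := by
    rintro m h ⟨q, n, r, hq, hr, rfl, rfl⟩ w
    exact ⟨q * w.const, n, r, isStarWord_mul.2 (.inl ⟨hq, isStarFree_const w⟩), hr,
      by rw [plug_mul, plug_const], (plugL_mul_right (plug_const w) _).symm⟩
  mul_left := by
    rintro m h ⟨q, n, r, hq, hr, rfl, rfl⟩ w
    exact ⟨w.const * q, n, r, isStarWord_mul.2 (.inr ⟨isStarFree_const w, hq⟩), hr,
      by rw [plug_mul, plug_const], (plugL_mul_left (plug_const w) _).symm⟩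

theorem IsRule.mem_below {lam : k} {m : OpWord DPOp Z} {r : MonoidAlgebra k (OpWord DPOp Z)}
    (hr : IsRule lam m r) : r ∈ below IsWord m := by
  cases hr with
  | pair A B u v => exact isStable_isWord.tail_left_mem lam A B (mem_upTo rfl) v
  | cancel u =>
    refine mem_below_of_mem_upTo (pdlt_of_degrees ?_) (mem_upTo rfl)
    simp

theorem below_isWord_coeff {r : MonoidAlgebra k (OpWord DPOp Z)} (hr : r ∈ below IsWord p)
    (w : OpWord DPOp Z) (hw : r.coeff w ≠ 0) : PDlt w p := by
  unfold below at hr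
  induction hr using Submodule.span_induction with
  | mem h hm =>
    obtain ⟨m, rfl, hmp⟩ := hm
    by_cases h : w = m
    · rwa [h]
    · simp [word, Ne.symm h] at hw
  | zero => simp at hw
  | add a b _ _ ha hb =>
    by_cases h : a.coeff w = 0
    · exact hb fun h' => hw (by simp [h, h'])
    · exact ha h
  | smul c a _ ha => exact ha fun h => hw (by simp [h])

theorem coeff_word_sub {m : OpWord DPOp Z} {r : MonoidAlgebra k (OpWord DPOp Z)}
    (hr : r ∈ below IsWord m) : (word m - r).coeff m = 1 := by
  have : r.coeff m = 0 := by
    by_contra h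
    exact (below_isWord_coeff hr m h).ne rfl
  simp [word, this]

theorem isLeadingMonomial_word_sub {m : OpWord DPOp Z} {r : MonoidAlgebra k (OpWord DPOp Z)}
    (hr : r ∈ below IsWord m) : IsLeadingMonomial PDle (word m - r) m := by
  refine ⟨by simp [coeff_word_sub hr, -MonoidAlgebra.coeff_sub], fun w hw => pdle_iff.2 ?_⟩
  by_cases h : w = m
  · exact .inr h
  · refine .inl (below_isWord_coeff hr w fun h' => ?_)
    simp [word, Ne.symm h, h'] at hw

theorem IsLeadingMonomial.unique {f : MonoidAlgebra k (OpWord DPOp Z)} {m n : OpWord DPOp Z}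
    (hm : IsLeadingMonomial PDle f m) (hn : IsLeadingMonomial PDle f n) : m = n :=
  isLinearOrder_pdle.antisymm _ _ (hn.2 m hm.1) (hm.2 n hn.1)

theorem trivialMod_of_mem_below {lam : k} (hh : h ∈ below (IsContext lam) p) :
    TrivialMod PDle (opiInstances (dRB lam) (Set.univ : Set (OpWord DPOp Z))) p h := by
  refine Submodule.span_mono ?_ hh
  rintro h ⟨m, ⟨q, n, r, hq, hr, rfl, rfl⟩, hmp⟩
  exact ⟨q, _, n, hq, mem_opiInstances_iff.2 ⟨n, r, hr, rfl⟩,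
    isLeadingMonomial_word_sub hr.mem_below, pdle_and_ne_iff.2 hmp, rfl⟩

/-- The instances are already monic, so dividing by the leading coefficient changes nothing. -/
theorem exists_rule_of_mem_monicization {lam : k} {f : MonoidAlgebra k (OpWord DPOp Z)}
    (hf : f ∈ monicization PDle (opiInstances (dRB lam) (Set.univ : Set (OpWord DPOp Z))))
    {m : OpWord DPOp Z} (hm : IsLeadingMonomial PDle f m) :
    ∃ r, IsRule lam m r ∧ f = word m - r := by
  obtain ⟨g, hg, n, hn, rfl⟩ := hf
  obtain ⟨m', r, hr, rfl⟩ := mem_opiInstances_iff.1 hg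
  have hl := isLeadingMonomial_word_sub hr.mem_below
  obtain rfl := IsLeadingMonomial.unique hl hn
  rw [coeff_word_sub hr.mem_below, inv_one, one_smul] at hm ⊢
  obtain rfl := IsLeadingMonomial.unique hl hm
  exact ⟨r, hr, rfl⟩

end Graded

end DRB

namespace DRB

open OpWord

/-! ### Triviality of the compositions. -/

section Compositions

set_option linter.unusedSimpArgs false
set_option linter.unusedSectionVars false

variable {k : Type*} [Field k] {Z : Type*} [LinearOrder Z] [WellFoundedLT Z]

theorem isContext_of_isRule {lam : k} {m : OpWord DPOp Z} {r : MonoidAlgebra k (OpWord DPOp Z)}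
    (hr : IsRule lam m r) : IsContext lam m (word m - r) :=
  ⟨var none, m, r, isStarWord_none, hr, rfl, (plugL_none _).symm⟩

theorem pair_word (lam : k) (A B : DPOp) (u v : OpWord DPOp Z) :
    pair lam A B (word u) (word v) =
      word (br A u * br B v) - tail lam A B (word u) (word v) := by
  rw [word_mul, word_br, word_br]; rfl

theorem cancel_word (u : OpWord DPOp Z) :
    (cancel (word u) : MonoidAlgebra k _) = word (br .D (br .P u)) - word u := by
  rw [word_br, word_br]; rfl

theorem isContext_pair (lam : k) (A B : DPOp) (u v : OpWord DPOp Z) :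
    IsContext lam (br A u * br B v) (pair lam A B (word u) (word v)) := by
  have := isContext_of_isRule (IsRule.pair (lam := lam) A B u v)
  rwa [word_mul, word_br, word_br] at this

theorem isContext_cancel (lam : k) (u : OpWord DPOp Z) :
    IsContext lam (br .D (br .P u)) (cancel (word u)) := by
  have := isContext_of_isRule (IsRule.cancel (lam := lam) u)
  rwa [word_br, word_br] at this

theorem mem_below_of_isContext {lam : k} {m p : OpWord DPOp Z}
    {h : MonoidAlgebra k (OpWord DPOp Z)} (hm : IsContext lam m h) (hp : PDlt m p) :
    h ∈ below (IsContext lam) p :=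
  Submodule.subset_span ⟨m, hm, hp⟩

section Irreducible

attribute [local irreducible] pair cancel opL word

theorem intersection_mem_below {lam : k} (hlam : lam ≠ 0) (A B C : DPOp) (u v w : OpWord DPOp Z) :
    pair lam A B (word u) (word v) * word (br C w) -
      word (br A u) * pair lam B C (word v) (word w) ∈
      below (IsContext lam) (br A u * br B v * br C w) := by
  have hE := isStable_isContext (Z := Z) lam
  have hu := degZ_pos u
  have hv := degZ_pos v
  have hw := degZ_pos w
  rw [word_br, word_br]
  generalize hp : br A u * br B v * br C w = p
  have smul {h} (c : k) (hh : h ∈ below (IsContext lam) p) : c • h ∈ below (IsContext lam) p :=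
    Submodule.smul_mem _ c hh
  have plain {A B a b} := mem_below_of_isContext (p := p) (isContext_pair lam A B a b)
  have left {A B a b c} := mem_below_of_isContext (p := p)
    (hE.mul_left (isContext_pair lam A B a b) c)
  have right {A B a b c} := mem_below_of_isContext (p := p)
    (hE.mul_right (isContext_pair lam A B a b) c)
  have opLeft {A B a b c ω} := mem_below_of_isContext (p := p)
    (hE.op (hE.mul_left (isContext_pair lam A B a b) c) ω)
  have opRight {A B a b c ω} := mem_below_of_isContext (p := p)
    (hE.op (hE.mul_right (isContext_pair lam A B a b) c) ω)
  cases A <;> cases B <;> cases C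
  -- The cases are numbered from `DDD` to `PPP`; going backwards keeps the remaining numbers valid
  -- while goals split.
  on_goal 8 =>
    rw [composition_PPP]
    simp only [← word_br, ← word_mul]
    refine add_mem (sub_mem (sub_mem (sub_mem (sub_mem (add_mem (add_mem (plain ?_) (plain ?_))
      (smul _ (plain ?_))) (plain ?_)) (plain ?_)) (smul _ (plain ?_))) (opLeft ?_)) (opRight ?_)
  on_goal 7 =>
    rw [composition_PPD]
    simp only [← word_br, ← word_mul]
    refine add_mem (add_mem (sub_mem (sub_mem (sub_mem (plain ?_) (plain ?_)) (plain ?_))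
      (smul _ (plain ?_))) (opRight ?_)) (smul _ (left ?_))
  on_goal 6 =>
    rw [composition_PDP]
    simp only [← word_br, ← word_mul]
    refine sub_mem (add_mem (sub_mem (plain ?_) (plain ?_)) (smul _ (left ?_)))
      (smul _ (right ?_))
  on_goal 5 =>
    rw [composition_PDD hlam]
    simp only [← word_br, ← word_mul]
    refine add_mem (sub_mem (sub_mem (smul _ (left ?_)) (plain ?_)) (smul _ (right ?_)))
      (smul _ (plain ?_))
  on_goal 4 =>
    rw [composition_DPP]
    simp only [← word_br, ← word_mul]
    refine sub_mem (sub_mem (sub_mem (add_mem (add_mem (plain ?_) (plain ?_)) (smul _ (plain ?_)))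
      (plain ?_)) (opLeft ?_)) (smul _ (right ?_))
  on_goal 3 =>
    rw [composition_DPD hlam]
    simp only [← word_br, ← word_mul]
    refine sub_mem (add_mem (sub_mem (plain ?_) (plain ?_)) (smul _ (left ?_)))
      (smul _ (right ?_))
  on_goal 2 =>
    rw [composition_DDP hlam]
    simp only [← word_br, ← word_mul]
    refine sub_mem (add_mem (sub_mem (smul _ (left ?_)) (smul _ (plain ?_))) (plain ?_))
      (smul _ (right ?_))
  on_goal 1 =>
    rw [composition_DDD]
    simp only [← word_br, ← word_mul]
    refine add_mem (sub_mem (sub_mem (smul _ (left ?_)) (smul _ (plain ?_)))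
      (smul _ (right ?_))) (smul _ (plain ?_))
  -- What remains is that the leading word of each instance on the right lies below `⌊u⌋_A ⌊v⌋_B
  -- ⌊w⌋_C`.
  all_goals
    subst hp
    refine pdlt_of_degrees ?_
    simp only [degOp_br, degOp_mul, degZ_br, degZ_mul, degGD_br, degGD_mul, degGP_br, degGP_mul,
      breadth_br, breadth_mul, eq_self, if_true, reduceCtorEq, if_false, mul_add, add_mul]
    clear smul plain left right opLeft opRight hE
    grind

theorem cancel_left_mem_below {lam : k} (hlam : lam ≠ 0) (B : DPOp) (u v : OpWord DPOp Z) :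
    pair lam .D B (word (br .P u)) (word v) - cancel (word u) * word (br B v) ∈
      below (IsContext lam) (br .D (br .P u) * br B v) := by
  have hE := isStable_isContext (Z := Z) lam
  have hu := degZ_pos u
  have hv := degZ_pos v
  rw [word_br, word_br]
  cases B
  on_goal 1 => rw [composition_cancel_D hlam]
  on_goal 2 => rw [composition_cancel_P]
  all_goals
    try simp only [← word_br, ← word_mul]
    repeat' with_reducible first | apply add_mem | apply sub_mem | apply Submodule.smul_mem
  all_goals
    with_reducible first
      | refine mem_below_of_isContext (isContext_pair _ _ _ _ _) ?_
      | refine mem_below_of_isContext (isContext_cancel _ _) ?_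
      | refine mem_below_of_isContext (hE.mul_right (isContext_cancel _ _) _) ?_
      | refine mem_below_of_isContext (hE.op (isContext_pair _ _ _ _ _) _) ?_
    refine pdlt_of_degrees ?_
    simp only [degOp_br, degOp_mul, degZ_br, degZ_mul, degGD_br, degGD_mul, degGP_br, degGP_mul,
      breadth_br, breadth_mul, eq_self, if_true, reduceCtorEq, if_false, mul_add, add_mul]
    grind

theorem cancel_right_mem_below {lam : k} (hlam : lam ≠ 0) (A : DPOp) (u v : OpWord DPOp Z) :
    pair lam A .D (word u) (word (br .P v)) - word (br A u) * cancel (word v) ∈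
      below (IsContext lam) (br A u * br .D (br .P v)) := by
  have hE := isStable_isContext (Z := Z) lam
  have hu := degZ_pos u
  have hv := degZ_pos v
  rw [word_br, word_br]
  cases A
  on_goal 1 => rw [composition_D_cancel hlam]
  on_goal 2 => rw [composition_P_cancel]
  all_goals
    try simp only [← word_br, ← word_mul]
    repeat' with_reducible first | apply add_mem | apply sub_mem | apply Submodule.smul_mem
  all_goals
    with_reducible first
      | refine mem_below_of_isContext (isContext_pair _ _ _ _ _) ?_
      | refine mem_below_of_isContext (isContext_cancel _ _) ?_
      | refine mem_below_of_isContext (hE.mul_left (isContext_cancel _ _) _) ?_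
      | refine mem_below_of_isContext (hE.op (isContext_pair _ _ _ _ _) _) ?_
    refine pdlt_of_degrees ?_
    simp only [degOp_br, degOp_mul, degZ_br, degZ_mul, degGD_br, degGD_mul, degGP_br, degGP_mul,
      breadth_br, breadth_mul, eq_self, if_true, reduceCtorEq, if_false, mul_add, add_mul]
    grind

end Irreducible

/-! ### Inclusions inside an argument, and the case analysis on contexts. -/

variable {lam : k} {q : OpWord DPOp (Option Z)} {n : OpWord DPOp Z}
  {s : MonoidAlgebra k (OpWord DPOp Z)}

theorem plugL_mem_upTo (hq : q.IsStarWord) (hs : IsRule lam n s) :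
    plugL q (word n - s) ∈ upTo (IsContext lam) (q.plug n) :=
  mem_upTo ⟨q, n, s, hq, hs, rfl, rfl⟩

theorem plugL_mem_below (hq : q.IsStarWord) (hs : IsRule lam n s) :
    plugL q s ∈ below IsWord (q.plug n) := by
  refine below_map (plugL q) q.plug (fun h => h.plug hq) ?_ hs.mem_below
  rintro m _ rfl
  exact plugL_word q m

/-- Splitting `q|_n = q|_(n-s) + q|_s` in the first argument turns the composition into `pair (q|_s)
v - tail (q|_(n-s)) v`. The first term consists of instances at words smaller than `q|_n`; the
second is a tail applied to an instance in context, so `tail_left_mem` bounds it. -/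
theorem inclusion_left_mem_below (hq : q.IsStarWord) (hs : IsRule lam n s) (A B : DPOp)
    (v : OpWord DPOp Z) :
    pair lam A B (word (q.plug n)) (word v) - opL A (plugL q (word n - s)) * word (br B v) ∈
      below (IsContext lam) (br A (q.plug n) * br B v) := by
  have hw := (isStable_isContext lam).tail_left_mem lam A B (plugL_mem_upTo hq hs) v
  have he : pair lam A B (plugL q s) (word v) ∈
      below (IsContext lam) (br A (q.plug n) * br B v) := by
    -- This linear map is `x ↦ pair x v`; it sends a word to an instance of the identity.
    refine below_map (LinearMap.mulRight k (opL B (word v)) ∘ₗ opL A - (tail lam A B).flip (word v))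
      (fun u => br A u * br B v) (fun h => (h.br A).mul_right _) ?_ (plugL_mem_below hq hs)
    rintro m _ rfl
    exact isContext_pair lam A B m v
  convert sub_mem he hw using 1
  have hx : word (q.plug n) = plugL q (word n - s) + plugL q s := by
    rw [← map_add, sub_add_cancel, plugL_word]
  rw [hx, word_br]
  simp only [pair, map_add, add_mul, LinearMap.add_apply]
  abel

theorem inclusion_right_mem_below (hq : q.IsStarWord) (hs : IsRule lam n s) (A B : DPOp)
    (u : OpWord DPOp Z) :
    pair lam A B (word u) (word (q.plug n)) - word (br A u) * opL B (plugL q (word n - s)) ∈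
      below (IsContext lam) (br A u * br B (q.plug n)) := by
  have hw := (isStable_isContext lam).tail_right_mem lam A B (plugL_mem_upTo hq hs) u
  have he : pair lam A B (word u) (plugL q s) ∈
      below (IsContext lam) (br A u * br B (q.plug n)) := by
    refine below_map (LinearMap.mulLeft k (opL A (word u)) ∘ₗ opL B - tail lam A B (word u))
      (fun v => br A u * br B v) (fun h => (h.br B).mul_left _) ?_ (plugL_mem_below hq hs)
    rintro m _ rfl
    exact isContext_pair lam A B u m
  convert sub_mem he hw using 1
  have hx : word (q.plug n) = plugL q (word n - s) + plugL q s := by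
    rw [← map_add, sub_add_cancel, plugL_word]
  rw [hx, word_br]
  simp only [pair, map_add, mul_add]
  abel

/-- The same splitting gives `cancel (q|_s) - q|_(n-s)`, and the second term is attached to a word
with fewer operators. -/
theorem inclusion_cancel_mem_below (hq : q.IsStarWord) (hs : IsRule lam n s) :
    cancel (word (q.plug n)) - opL .D (opL .P (plugL q (word n - s))) ∈
      below (IsContext lam) (br .D (br .P (q.plug n))) := by
  have hw : plugL q (word n - s) ∈ below (IsContext lam) (br .D (br .P (q.plug n))) :=
    mem_below_of_mem_upTo (pdlt_of_degrees (by simp)) (plugL_mem_upTo hq hs)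
  have he : cancel (plugL q s) ∈ below (IsContext lam) (br .D (br .P (q.plug n))) := by
    refine below_map (opL .D ∘ₗ opL .P - LinearMap.id) (fun u => br .D (br .P u))
      (fun h => (h.br .P).br .D) ?_ (plugL_mem_below hq hs)
    rintro m _ rfl
    exact isContext_cancel lam m
  convert sub_mem he hw using 1
  have hx : word (q.plug n) = plugL q (word n - s) + plugL q s := by
    rw [← map_add, sub_add_cancel, plugL_word]
  rw [hx]
  simp only [cancel, map_add]
  abel

theorem IsRule.eq_of_breadth (hs : IsRule lam n s) (hn : n.breadth = 1) :
    ∃ a, n = br .D (br .P a) ∧ s = word a := by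
  cases hs with
  | pair A B u v => simp at hn
  | cancel u => exact ⟨u, rfl, rfl⟩

theorem IsRule.unique {m : OpWord DPOp Z} {r : MonoidAlgebra k (OpWord DPOp Z)}
    (hr : IsRule lam m r) (hs : IsRule lam n s) (h : m = n) : r = s := by
  cases hr with
  | pair A B u v =>
    cases hs with
    | pair A' B' u' v' =>
      rw [OpWord.br_mul, OpWord.br_mul] at h
      injection h with h1 h2 h3
      injection h3 with h3 h4
      rw [h1, h2, h3, h4]
    | cancel u' => exact absurd (congrArg breadth h) (by simp)
  | cancel u =>
    cases hs with
    | pair A' B' u' v' => exact absurd (congrArg breadth h) (by simp)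
    | cancel u' =>
      injection h with _ h
      injection h with _ h
      rw [h]

/-- The shape of `q` locates the hole. An empty context gives the same rule twice, hence zero. A
hole that is a whole factor of a product has breadth 1, which forces `n = D(P(a))`. Otherwise the
hole lies inside an argument. All other shapes contradict breadth or the first letter, except the
hole directly under the outer `D` of `D(P(u))`. -/
theorem inclusion_mem_below (hlam : lam ≠ 0) {m : OpWord DPOp Z}
    {r : MonoidAlgebra k (OpWord DPOp Z)} (hr : IsRule lam m r) (hs : IsRule lam n s)
    (hq : q.IsStarWord) (h : m = q.plug n) :
    word m - r - plugL q (word n - s) ∈ below (IsContext lam) m := by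
  cases hr with
  | pair A B u v =>
    have hpos (q' : OpWord DPOp (Option Z)) := breadth_pos (q'.plug n)
    cases q with
    | var o =>
      cases o with
      | none =>
        rw [plugL_none, (IsRule.pair A B u v).unique hs h, h, plug_none, sub_self]
        exact zero_mem _
      | some z => exact absurd hq (not_isStarWord_some (Ω := DPOp) z)
    | br ω q => exact absurd (congrArg breadth h) (by simp)
    | consVar o q =>
      cases o with
      | none =>
        rw [← OpWord.var_mul] at h hq ⊢
        have hq' : q.IsStarFree := by
          rcases isStarWord_mul.1 hq with h | h
          · exact h.2
          · exact absurd h.1 not_isStarFree_none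
        rw [plug_mul, plug_none] at h
        have hb := congrArg breadth h
        simp only [breadth_mul, breadth_br] at hb
        have := hpos q
        have := breadth_pos n
        obtain ⟨a, rfl, rfl⟩ := hs.eq_of_breadth (by omega)
        rw [OpWord.br_mul, OpWord.br_mul] at h
        injection h with h1 h2 h3
        subst h1 h2
        have hq'' (w : OpWord DPOp Z) : q.plug w = br B v := (hq'.plug_eq _ _).trans h3.symm
        rw [← pair_word, plugL_mul_right hq'', plugL_none, ← cancel_word]
        exact cancel_left_mem_below hlam B a v
      | some z =>
        rw [OpWord.br_mul, ← OpWord.var_mul, plug_mul, plug_some, OpWord.var_mul] at h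
        cases h
    | consBr ω q q' =>
      rw [← OpWord.br_mul] at h hq ⊢
      rw [plug_mul, plug_br, OpWord.br_mul, OpWord.br_mul] at h
      injection h with h1 h2 h3
      subst h1 h2
      rcases isStarWord_mul.1 hq with ⟨hq, hq'⟩ | ⟨hq, hq'⟩
      · have hq'' (w : OpWord DPOp Z) : q'.plug w = br B v := (hq'.plug_eq _ _).trans h3.symm
        rw [← pair_word, plugL_mul_right hq'', plugL_br]
        exact inclusion_left_mem_below (q := q) hq hs A B v
      · have hq'' (w : OpWord DPOp Z) : (br A q).plug w = br A (q.plug n) := hq.plug_eq _ _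
        rw [← pair_word, plugL_mul_left hq'']
        generalize q.plug n = u
        cases q' with
        | var o =>
          cases o with
          | none =>
            rw [plug_none] at h3
            obtain ⟨a, rfl, rfl⟩ := hs.eq_of_breadth (by rw [← h3]; rfl)
            injection h3 with h1 h2
            subst h1 h2
            rw [plugL_none, ← cancel_word]
            exact cancel_right_mem_below hlam A u a
          | some z => exact absurd hq' (not_isStarWord_some z)
        | br ω q' =>
          rw [plug_br] at h3
          injection h3 with h1 h2
          subst h1 h2
          rw [plugL_br]
          exact inclusion_right_mem_below (q := q') hq' hs A B u
        | consVar o q' =>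
          rw [← OpWord.var_mul, plug_mul] at h3
          have := congrArg breadth h3
          have := hpos (var o)
          have := hpos q'
          simp only [breadth_mul, breadth_br] at *
          omega
        | consBr ω q₁ q₂ =>
          rw [← OpWord.br_mul, plug_mul] at h3
          have := congrArg breadth h3
          have := hpos (br ω q₁)
          have := hpos q₂
          simp only [breadth_mul, breadth_br] at *
          omega
  | cancel u =>
    have hmul (q₁ q₂ : OpWord DPOp (Option Z)) (ω : DPOp) (w : OpWord DPOp Z) :
        br ω w ≠ (q₁ * q₂).plug n := fun h => by
      have hb := congrArg breadth h
      have := breadth_pos (q₁.plug n)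
      have := breadth_pos (q₂.plug n)
      rw [plug_mul, breadth_mul, breadth_br] at hb
      omega
    cases q with
    | var o =>
      cases o with
      | none =>
        rw [plugL_none, (IsRule.cancel u).unique hs h, h, plug_none, sub_self]
        exact zero_mem _
      | some z => exact absurd hq (not_isStarWord_some (Ω := DPOp) z)
    | consVar o q => exact absurd h (hmul (var o) q _ _)
    | consBr ω q₁ q₂ => exact absurd h (hmul (br ω q₁) q₂ _ _)
    | br ω q =>
      rw [plug_br] at h
      injection h with h1 h2
      subst h1
      cases q with
      | var o =>
        cases o with
        | none =>
          rw [plug_none] at h2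
          -- Here `n` would be `P(u)`, but a leading word of breadth 1 starts with `D`.
          obtain ⟨a, rfl, rfl⟩ := hs.eq_of_breadth (by rw [← h2]; rfl)
          injection h2 with h _
          cases h
        | some z => exact absurd hq (not_isStarWord_some (Ω := DPOp) z)
      | consVar o q => exact absurd h2 (hmul (var o) q _ _)
      | consBr ω q₁ q₂ => exact absurd h2 (hmul (br ω q₁) q₂ _ _)
      | br ω q =>
        rw [plug_br] at h2
        injection h2 with h1 h2
        subst h1 h2
        rw [← cancel_word, plugL_br, plugL_br]
        exact inclusion_cancel_mem_below hq hs

theorem isGSBasis_dRB (hlam : lam ≠ 0) :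
    IsGSBasis PDle (opiInstances (dRB lam) (Set.univ : Set (OpWord DPOp Z))) where
  intersection f hf g hg f' g' p u v hf' hg' hp hp' hlt hlt' := by
    obtain ⟨r, hr, rfl⟩ := exists_rule_of_mem_monicization hf hf'
    obtain ⟨s, hs, rfl⟩ := exists_rule_of_mem_monicization hg hg'
    refine trivialMod_of_mem_below ?_
    have hb := congrArg breadth hp
    have hb' := congrArg breadth hp'
    rw [breadth_mul] at hb hb'
    have hu := breadth_pos u
    have hv := breadth_pos v
    cases hr with
    -- A leading word of breadth 1 leaves no room for a proper overlap.
    | cancel a => simp only [breadth_br] at *; omega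
    | pair A B a b =>
      cases hs with
      | cancel c => simp only [breadth_br] at *; omega
      | pair B' C b' c =>
        simp only [breadth_br, breadth_mul] at *
        have hl := congrArg letters (hp.symm.trans hp')
        simp only [letters_mul] at hl
        -- Two leading words of breadth 2 give `2 < |p| < 4`, so `u` and `v` are single letters and
        -- the rules share the middle one.
        obtain ⟨l, hl1⟩ := List.length_eq_one_iff.1 (show u.letters.length = 1 by
          change u.breadth = 1; omega)
        obtain ⟨l', hl2⟩ := List.length_eq_one_iff.1 (show v.letters.length = 1 by
          change v.breadth = 1; omega)
        rw [hl1, hl2] at hl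
        simp only [letters, List.cons_append, List.nil_append, List.cons.injEq, OpLetter.br.injEq,
          and_true] at hl
        obtain ⟨rfl, ⟨rfl, rfl⟩, rfl⟩ := hl
        obtain rfl : u = br C c := letters_injective hl1
        obtain rfl : v = br A a := letters_injective hl2
        subst hp
        convert intersection_mem_below hlam A B C a b c using 1
        rw [pair_word, pair_word]
        rfl
  inclusion f hf g hg f' g' p q hq hf' hg' hp hp' := by
    obtain ⟨r, hr, rfl⟩ := exists_rule_of_mem_monicization hf hf'
    obtain ⟨s, hs, rfl⟩ := exists_rule_of_mem_monicization hg hg'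
    subst hp
    exact trivialMod_of_mem_below (inclusion_mem_below hlam hr hs hq hp')

end Compositions

end DRB

theorem theoremS2 {k : Type*} [Field k] (lam : k) (hlam : lam ≠ 0)
    {Z : Type*} [LinearOrder Z] [WellFoundedLT Z] :
    IsOmegaGS (DRB.dRB lam) (OpWord.PDle : OpWord DPOp Z → OpWord DPOp Z → Prop) :=
  ⟨OpWord.isMonomialOrder_pdle, DRB.isGSBasis_dRB hlam⟩
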